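/- Notation. Let $\mathbb D=\{|z|<1\}$, $\Gamma=\{|z|=1\}$, $\overline{\mathbb C}=\mathbb C\cup\{\infty\}$, and $d_{ph}(z,w)=\left|\frac{z-w}{1-z\overline w}\right|$. A meromorphic function $f:\mathbb D\to\overline{\mathbb C}$ is *normal* if every sequence in the family $\{f\circ\varphi:\varphi \text{ a conformal automorphism of }\mathbb D\}$ has a subsequence which converges uniformly on the compact subsets of $\mathbb D$ in the spherical metric. For $A\subseteq\mathbb D$ let $C(f,A,e^{i\theta})$ be the set of all $w\in\overline{\mathbb C}$ for which there are $z_n\in A$ with $z_n\to e^{i\theta}$ and $f(z_n)\to w$. Let $\gamma$ be a simple curve in $\mathbb D$ (the injective continuous image of $[0,1)$) which terminates in $e^{i\theta}\in\Gamma$ and is tangent to $\Gamma$ there, i.e. the direction from $e^{i\theta}$ to the moving point of $\gamma$ tends to one of the two tangent directions $\pm ie^{i\theta}$. For $r,\rho\in(0,1)$ and $\alpha\in(0,\pi)$ put $$\Delta_r\gamma=\bigcup_{w\in\gamma}\{z\in\mathbb D: d_{ph}(z,w)\le r\},$$ let $h(\theta,\alpha)$ be the chord of $\mathbb D$ from $e^{i\theta}$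 which makes the angle $\alpha$ with the tangent to $\Gamma$ (it has direction $ie^{i\theta}e^{i\alpha}$), and let $\Delta_{\alpha,\rho}\gamma$ be the region in $\mathbb D\cap\{|z-e^{i\theta}|<\rho\}$ bounded by $\gamma$, by $h(\theta,\alpha)$ and by the circle $|z-e^{i\theta}|=\rho$; precisely, the union of all domains $U\subseteq\mathbb D\cap\{|z-e^{i\theta}|<\rho\}$ with $$\partial U\subseteq \gamma\cup h(\theta,\alpha)\cup\{z\in\mathbb D:|z-e^{i\theta}|=\rho\}\cup\{e^{i\theta}\}.$$ Put $G^\theta_{\gamma,r,\alpha,\rho}=\Delta_r\gamma\cup\Delta_{\alpha,\rho}\gamma$. Theorem. Let $f$ be a normal meromorphic function in $\mathbb D$ and suppose that $\lim_{\gamma\ni z\to e^{i\theta}}f(z)=c\in\overline{\mathbb C}$. Then for all $r,\rho\in(0,1)$ and $\alpha\in(0,\pi)$ $$C(f,G^\theta_{\gamma,r,\alpha,\rho},e^{i\theta})=\{c\}\quad\text{and}\quad \Delta_{\alpha,\rho}\gamma\subsetneq G^\theta_{\gamma,r,\alpha,\rho}.$$ In particular $$\bigcup_{r,\rho\in(0,1),\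 \alpha\in(0,\pi)}C(f,G^\theta_{\gamma,r,\alpha,\rho},e^{i\theta})=\{c\}.$$ -/

import Mathlib

open Filter Topology Set
open scoped OnePoint

/-- The open unit disc `𝔻` in `ℂ`. -/
def unitDisc : Set ℂ := {z | ‖z‖ < 1}

/-- The point `e^{iθ}` of the unit circle. -/
noncomputable def circlePt (θ : ℝ) : ℂ := Complex.exp (θ * Complex.I)

/-- The pseudo-hyperbolic distance of two points of the disc. -/
noncomputable def pseudoHypDist (z w : ℂ) : ℝ :=
  ‖(z - w) / (1 - z * (starRingEnd ℂ) w)‖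

/-- The spherical (chordal) metric on the extended plane `ℂ ∪ {∞}`. -/
noncomputable def sphericalDist : OnePoint ℂ → OnePoint ℂ → ℝ
  | OnePoint.some z, OnePoint.some w =>
      2 * ‖z - w‖ / (Real.sqrt (1 + ‖z‖ ^ 2) * Real.sqrt (1 + ‖w‖ ^ 2))
  | OnePoint.some z, OnePoint.infty => 2 / Real.sqrt (1 + ‖z‖ ^ 2)
  | OnePoint.infty, OnePoint.some w => 2 / Real.sqrt (1 + ‖w‖ ^ 2)
  | OnePoint.infty, OnePoint.infty => 0

/-- `f` is meromorphic in the disc, as a map into the Riemann sphere: on the disc it is the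
sphere-valued extension (by limits, so with value `∞` exactly at the poles) of a meromorphic
function `g`. Only the values of `f` on the disc matter. -/
def IsMeromorphicOnDisc (f : ℂ → OnePoint ℂ) : Prop :=
  ∃ g : ℂ → ℂ, MeromorphicOn g unitDisc ∧
    ∀ z ∈ unitDisc, Tendsto (fun w => (g w : OnePoint ℂ)) (𝓝[≠] z) (𝓝 (f z))

/-- `φ` restricts to a conformal automorphism of the disc. -/
def IsDiscAutomorphism (φ : ℂ → ℂ) : Prop :=
  DifferentiableOn ℂ φ unitDisc ∧ BijOn φ unitDisc unitDisc

/-- `F n → g` in the spherical metric, uniformly on the compact subsets of the disc. -/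
def TendstoSphericallyOnCompacts (F : ℕ → ℂ → OnePoint ℂ) (g : ℂ → OnePoint ℂ) : Prop :=
  ∀ K : Set ℂ, IsCompact K → K ⊆ unitDisc →
    ∀ ε : ℝ, 0 < ε → ∃ N : ℕ, ∀ n ≥ N, ∀ z ∈ K, sphericalDist (F n z) (g z) < ε

/-- `f` is normal in the disc: the family of all `f ∘ φ`, with `φ` a conformal automorphism of
the disc, is a normal family in the sense of Montel. -/
def IsNormalOnDisc (f : ℂ → OnePoint ℂ) : Prop :=
  ∀ φ : ℕ → ℂ → ℂ, (∀ n, IsDiscAutomorphism (φ n)) →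
    ∃ k : ℕ → ℕ, StrictMono k ∧ ∃ g : ℂ → OnePoint ℂ,
      TendstoSphericallyOnCompacts (fun n z => f (φ (k n) z)) g

/-- The cluster set `C(f, A, ζ)`. -/
def clusterSetAlong (f : ℂ → OnePoint ℂ) (A : Set ℂ) (ζ : ℂ) : Set (OnePoint ℂ) :=
  {w | ∃ z : ℕ → ℂ, (∀ n, z n ∈ A) ∧ Tendsto z atTop (𝓝 ζ) ∧
    Tendsto (fun n => f (z n)) atTop (𝓝 w)}

/-- `γ`, restricted to `[0, 1)`, is a simple curve in the disc which terminates in `ζ`. -/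
structure IsSimpleCurveEndingAt (γ : ℝ → ℂ) (ζ : ℂ) : Prop where
  continuousOn : ContinuousOn γ (Ico 0 1)
  injOn : InjOn γ (Ico 0 1)
  mapsTo : MapsTo γ (Ico 0 1) unitDisc
  tendsto : Tendsto γ (𝓝[<] 1) (𝓝 ζ)

/-- The point set of the curve. -/
def curveTrace (γ : ℝ → ℂ) : Set ℂ := γ '' Ico 0 1

/-- `γ` is tangent to the unit circle at its end point `ζ`, `‖ζ‖ = 1`: the direction from `ζ` to
the moving point of the curve tends to one of the two unit tangent directions `± i ζ`. -/
def IsTangentToCircleAt (γ : ℝ → ℂ) (ζ : ℂ) : Prop :=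
  Tendsto (fun t => (γ t - ζ) / (‖γ t - ζ‖ : ℂ)) (𝓝[<] 1) (𝓝 (Complex.I * ζ)) ∨
  Tendsto (fun t => (γ t - ζ) / (‖γ t - ζ‖ : ℂ)) (𝓝[<] 1) (𝓝 (-(Complex.I * ζ)))

/-- The curvilinear angle `Δ_r γ`: the union of the closed pseudo-hyperbolic discs of radius `r`
centred on the curve. -/
def curvilinearAngle (γ : ℝ → ℂ) (r : ℝ) : Set ℂ :=
  {z | z ∈ unitDisc ∧ ∃ w ∈ curveTrace γ, pseudoHypDist z w ≤ r}

/-- The chord of the disc issuing from `e^{iθ}` which makes the angle `α ∈ (0, π)` with the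
tangent direction `i e^{iθ}`. As `α` runs over `(0, π)`, these are all the chords from `e^{iθ}`
(`α = π / 2` is the diameter). -/
noncomputable def chordAt (θ α : ℝ) : Set ℂ :=
  {z | z ∈ unitDisc ∧ ∃ t : ℝ, 0 < t ∧
    z = circlePt θ + t * (Complex.I * circlePt θ * Complex.exp (α * Complex.I))}

/-- `U` is a sub-domain of the disc, inside the circle of radius `ρ` about `e^{iθ}`, which is
bounded by the curve `γ`, the chord with angle `α` and that circle: apart from the vertex `e^{iθ}`
its frontier lies on these three, and so does not meet the unit circle. -/
structure IsDomainBoundedBy (γ : ℝ → ℂ) (θ α ρ : ℝ) (U : Set ℂ) : Prop where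
  isOpen : IsOpen U
  isConnected : IsConnected U
  subset_disc : U ⊆ unitDisc
  subset_ball : U ⊆ Metric.ball (circlePt θ) ρ
  frontier_subset : frontier U ⊆ curveTrace γ ∪ chordAt θ α ∪
    (Metric.sphere (circlePt θ) ρ ∩ unitDisc) ∪ {circlePt θ}

/-- `Δ_{α,ρ} γ`: the region bounded by `γ`, the chord and the arc of the circle of radius `ρ`
about `e^{iθ}`. When `γ` enters the circle once and does not meet the chord inside it, exactly one
domain is bounded by the three; in general all domains which they bound are taken together. -/
def chordalRegion (γ : ℝ → ℂ) (θ α ρ : ℝ) : Set ℂ :=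
  ⋃₀ {U | IsDomainBoundedBy γ θ α ρ U}

/-- `G = Δ_r γ ∪ Δ_{α,ρ} γ`. -/
def enlargedRegion (γ : ℝ → ℂ) (θ r α ρ : ℝ) : Set ℂ :=
  curvilinearAngle γ r ∪ chordalRegion γ θ α ρ

/-! The Cayley transform taking `e^{iθ}` to `∞` carries the disc to the upper half-plane `H`. There
`γ` becomes a closed connected set `C` whose slope tends to `0` on one side, the chord becomes a ray
from `-i`, and the circle of radius `ρ` becomes `|w + i| = 2 / ρ`, irrelevant far out. Normality is
used only for the maps `w ↦ s w + x` with `s > 0` and `x` real: rescaled copies of `F = f ∘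
fromHalf` subconverge to sphere-valued holomorphic maps, and such a limit is constantly `c` as soon
as it takes the value `c` on a set accumulating in `H`. Each convergence claim is proved by
contradiction, by rescaling at bad points and finding enough points where the limit is `c`.

On `Δ_r γ` (`eventually_mem_of_compact`), rescale so that a point of `C` goes to `i`. The connected
set `C` crosses every small circle about `i`, so the limit takes the value `c` on points
accumulating at `i`.

On the domains of `Δ_{α,ρ} γ` there are two stages, with bounds uniform over the domains. At small
slope (`eventually_mem_of_low`) compactness fails; one takes a bad point which is lowest up to a
cone. In a box below it `F` is within `η` of `c`, and the frontier there lies on `C`, where `F` is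
as close to `c` as desired. The domain does not touch the real line because its frontier avoids the
unit circle, so a two-constants estimate gives the value `c` to the rescaled limit on a vertical
segment, hence everywhere, against badness at `i`. Between small slopes and the ray
(`eventually_mem_of_boundedByRay_coe`), rescaling by the distance to `-i` gives a limit equal to `c`
on an arc of small angles, hence everywhere. The case `c = ∞` reduces to `0` by inversion.

The inclusion is strict because the lowest point of `C` on a large circle about `-i` is in none of
the domains (`exists_not_mem_of_boundedByRay`): otherwise the arc below it would stay in the domain
and leave `H`. -/

/-! ### The Riemann sphere -/

/-- The inversion `w ↦ 1 / w` of the extended plane. -/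
noncomputable def sphInv : OnePoint ℂ → OnePoint ℂ
  | OnePoint.some z => if z = 0 then OnePoint.infty else OnePoint.some z⁻¹
  | OnePoint.infty => OnePoint.some 0

/-- The finite part of a point of the extended plane, with `∞ ↦ 0`. -/
def finitePart : OnePoint ℂ → ℂ
  | OnePoint.some z => z
  | OnePoint.infty => 0

@[simp] lemma sphInv_infty : sphInv OnePoint.infty = ((0 : ℂ) : OnePoint ℂ) := rfl

@[simp] lemma sphInv_zero : sphInv ((0 : ℂ) : OnePoint ℂ) = OnePoint.infty := if_pos rfl

lemma sphInv_coe {z : ℂ} (hz : z ≠ 0) : sphInv (z : OnePoint ℂ) = ((z⁻¹ : ℂ) : OnePoint ℂ) :=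
  if_neg hz

@[simp] lemma finitePart_coe (z : ℂ) : finitePart (z : OnePoint ℂ) = z := rfl

lemma coe_finitePart {w : OnePoint ℂ} (hw : w ≠ OnePoint.infty) :
    ((finitePart w : ℂ) : OnePoint ℂ) = w := by
  induction w using OnePoint.rec with
  | infty => exact absurd rfl hw
  | coe z => rfl

@[simp] lemma sphInv_sphInv (w : OnePoint ℂ) : sphInv (sphInv w) = w := by
  induction w using OnePoint.rec with
  | infty => simp
  | coe z =>
    by_cases hz : z = 0
    · simp [hz]
    · rw [sphInv_coe hz, sphInv_coe (inv_ne_zero hz), inv_inv]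

lemma continuous_sphInv : Continuous sphInv := by
  have hev : ∀ᶠ z : ℂ in Bornology.cobounded ℂ, sphInv (z : OnePoint ℂ) = ((z⁻¹ : ℂ) : OnePoint ℂ) := by
    have : ∀ᶠ z : ℂ in Bornology.cobounded ℂ, z ≠ 0 := by
      filter_upwards [tendsto_norm_cobounded_atTop.eventually (eventually_gt_atTop 0)] with z hz
      simpa using hz
    exact this.mono fun z hz => sphInv_coe hz
  rw [OnePoint.continuous_iff]
  constructor
  · rw [coclosedCompact_eq_cocompact, ← Metric.cobounded_eq_cocompact]
    refine Tendsto.congr' (EventuallyEq.symm hev) ?_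
    exact OnePoint.continuous_coe.continuousAt.tendsto.comp tendsto_inv₀_cobounded
  · rw [continuous_iff_continuousAt]
    intro z
    by_cases hz : z = 0
    · subst hz
      rw [continuousAt_iff_punctured_nhds]
      have h1 : Tendsto (fun z : ℂ => z⁻¹) (𝓝[≠] 0) (coclosedCompact ℂ) := by
        rw [coclosedCompact_eq_cocompact, ← Metric.cobounded_eq_cocompact]
        exact Filter.tendsto_inv₀_nhdsNE_zero
      have h2 := OnePoint.tendsto_coe_infty.comp h1
      simp only [sphInv_zero]
      refine h2.congr' ?_
      filter_upwards [self_mem_nhdsWithin] with w hw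
      exact (sphInv_coe hw).symm
    · have : ∀ᶠ w in 𝓝 z, ((w⁻¹ : ℂ) : OnePoint ℂ) = sphInv (w : OnePoint ℂ) := by
        filter_upwards [isOpen_ne.mem_nhds hz] with w hw
        exact (sphInv_coe hw).symm
      refine ContinuousAt.congr ?_ this
      exact OnePoint.continuous_coe.continuousAt.comp (continuousAt_inv₀ hz)

lemma continuousAt_finitePart {w : OnePoint ℂ} (hw : w ≠ OnePoint.infty) :
    ContinuousAt finitePart w := by
  rw [← coe_finitePart hw, OnePoint.continuousAt_coe]
  exact continuousAt_id

/-! ### Sphere-valued holomorphic maps and the identity theorem. -/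

/-- A sphere-valued map is holomorphic at `z`, as seen in one of the two charts. -/
def SphericallyAnalyticAt (F : ℂ → OnePoint ℂ) (z : ℂ) : Prop :=
  ∃ h : ℂ → ℂ, AnalyticAt ℂ h z ∧
    ((∀ᶠ w in 𝓝 z, F w = h w) ∨ ∀ᶠ w in 𝓝 z, F w = sphInv (h w))

namespace SphericallyAnalyticAt

variable {F : ℂ → OnePoint ℂ} {z : ℂ}

lemma continuousAt (hF : SphericallyAnalyticAt F z) : ContinuousAt F z := by
  obtain ⟨h, ha, h1 | h1⟩ := hF
  · exact (OnePoint.continuous_coe.continuousAt.comp ha.continuousAt).congr (EventuallyEq.symm h1)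
  · exact (continuous_sphInv.continuousAt.comp
      (OnePoint.continuous_coe.continuousAt.comp ha.continuousAt)).congr (EventuallyEq.symm h1)

lemma sphInv_comp (hF : SphericallyAnalyticAt F z) :
    SphericallyAnalyticAt (fun w => sphInv (F w)) z := by
  obtain ⟨h, ha, h1 | h1⟩ := hF
  · exact ⟨h, ha, Or.inr (h1.mono fun w hw => congrArg sphInv hw)⟩
  · exact ⟨h, ha, Or.inl (h1.mono fun w hw =>
      (congrArg sphInv hw).trans (sphInv_sphInv _))⟩

lemma comp {φ : ℂ → ℂ} (hF : SphericallyAnalyticAt F (φ z)) (hφ : AnalyticAt ℂ φ z) :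
    SphericallyAnalyticAt (fun w => F (φ w)) z := by
  obtain ⟨h, ha, h1⟩ := hF
  exact ⟨fun w => h (φ w), ha.comp hφ, h1.imp (fun h1 => hφ.continuousAt.eventually h1)
    (fun h1 => hφ.continuousAt.eventually h1)⟩

lemma analyticAt_finitePart (hF : SphericallyAnalyticAt F z) (hz : F z ≠ OnePoint.infty) :
    AnalyticAt ℂ (fun w => finitePart (F w)) z := by
  obtain ⟨h, ha, h1 | h1⟩ := hF
  · exact ha.congr (h1.mono fun w hw => by simp [hw])
  · have h0 : h z ≠ 0 := by
      intro h0
      rw [h1.self_of_nhds, h0, sphInv_zero] at hz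
      exact hz rfl
    refine (ha.inv h0).congr ?_
    filter_upwards [h1, ha.continuousAt.eventually_ne h0] with w hw hw0
    rw [hw, sphInv_coe hw0, finitePart_coe, Pi.inv_apply]

lemma eventually_eq_of_frequently_eq {c : OnePoint ℂ} (hF : SphericallyAnalyticAt F z)
    (hc : ∃ᶠ w in 𝓝[≠] z, F w = c) : ∀ᶠ w in 𝓝 z, F w = c := by
  have key : ∀ {h : ℂ → ℂ} {d : OnePoint ℂ}, AnalyticAt ℂ h z →
      (∃ᶠ w in 𝓝[≠] z, (h w : OnePoint ℂ) = d) → ∀ᶠ w in 𝓝 z, (h w : OnePoint ℂ) = d := by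
    intro h d ha hd
    induction d using OnePoint.rec with
    | infty => obtain ⟨w, hw⟩ := hd.exists; exact absurd hw (OnePoint.coe_ne_infty _)
    | coe d =>
      simp only [OnePoint.coe_eq_coe] at hd ⊢
      exact (ha.frequently_eq_iff_eventually_eq analyticAt_const).1 hd
  obtain ⟨h, ha, h1 | h1⟩ := hF
  · have := key (d := c) ha ((hc.and_eventually (h1.filter_mono nhdsWithin_le_nhds)).mono
      fun w hw => by rw [← hw.2, hw.1])
    filter_upwards [this, h1] with w hw1 hw2
    rw [hw2, hw1]
  · have := key (d := sphInv c) ha ((hc.and_eventually (h1.filter_mono nhdsWithin_le_nhds)).mono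
      fun w hw => by rw [← hw.1, hw.2, sphInv_sphInv])
    filter_upwards [this, h1] with w hw1 hw2
    rw [hw2, hw1, sphInv_sphInv]

end SphericallyAnalyticAt

lemma eventually_nhdsNE_ne (w z : ℂ) : ∀ᶠ x in 𝓝[≠] w, x ≠ z := by
  by_cases h : w = z
  · subst h; exact self_mem_nhdsWithin
  · exact nhdsWithin_le_nhds (isOpen_ne.mem_nhds h)

/-- Identity theorem for sphere-valued holomorphic maps. -/
lemma eqOn_const_of_frequently_eq {F : ℂ → OnePoint ℂ} {D : Set ℂ} (hD : IsPreconnected D)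
    (hF : ∀ z ∈ D, SphericallyAnalyticAt F z) {c : OnePoint ℂ} {z₀ : ℂ} (hz₀ : z₀ ∈ D)
    (hc : ∃ᶠ w in 𝓝[≠] z₀, F w = c) : ∀ z ∈ D, F z = c := by
  set u : Set ℂ := {z | ∀ᶠ w in 𝓝 z, F w = c} with hu
  have hopen : IsOpen u := isOpen_setOfPred_eventually_nhds
  have hsub : D ⊆ u := by
    refine hD.subset_of_closure_inter_subset hopen
      ⟨z₀, hz₀, (hF z₀ hz₀).eventually_eq_of_frequently_eq hc⟩ ?_
    rintro z ⟨hz, hzD⟩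
    refine (hF z hzD).eventually_eq_of_frequently_eq ?_
    rw [mem_closure_iff_frequently] at hz
    rw [frequently_nhdsWithin_iff, frequently_iff]
    intro s hs
    obtain ⟨t, hts, ht, hzt⟩ := mem_nhds_iff.1 hs
    obtain ⟨w, hwt, hwu⟩ := (frequently_iff.1 hz) (ht.mem_nhds hzt)
    have h1 : ∀ᶠ x in 𝓝[≠] w, F x = c ∧ x ∈ t :=
      (hwu.and (ht.mem_nhds hwt)).filter_mono nhdsWithin_le_nhds
    have h2 : ∀ᶠ x in 𝓝[≠] w, x ≠ z := eventually_nhdsNE_ne w z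
    obtain ⟨x, ⟨hx1, hx2⟩, hx3⟩ := (h1.and h2).exists
    exact ⟨x, hts hx2, hx1, hx3⟩
  exact fun z hz => (hsub hz).self_of_nhds

/-! ### Limits of sphere-valued holomorphic maps. -/

/-- Continuous convergence at the points of `D`. -/
def ContinuouslyConvergesOn (F : ℕ → ℂ → OnePoint ℂ) (g : ℂ → OnePoint ℂ) (D : Set ℂ) : Prop :=
  ∀ z ∈ D, Tendsto (fun p : ℕ × ℂ => F p.1 p.2) (atTop ×ˢ 𝓝 z) (𝓝 (g z))

namespace ContinuouslyConvergesOn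

variable {F : ℕ → ℂ → OnePoint ℂ} {g : ℂ → OnePoint ℂ} {D : Set ℂ}

lemma tendsto_comp (h : ContinuouslyConvergesOn F g D) {z : ℂ} (hz : z ∈ D) {ι : Type*}
    {l : Filter ι} {k : ι → ℕ} (hk : Tendsto k l atTop) {w : ι → ℂ} (hw : Tendsto w l (𝓝 z)) :
    Tendsto (fun n => F (k n) (w n)) l (𝓝 (g z)) :=
  (h z hz).comp (hk.prodMk hw)

lemma sphInv_comp (h : ContinuouslyConvergesOn F g D) :
    ContinuouslyConvergesOn (fun n w => sphInv (F n w)) (fun w => sphInv (g w)) D :=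
  fun z hz => (continuous_sphInv.tendsto _).comp (h z hz)

/-- For a closed neighbourhood `N` of `g z`, the values `F n w` lie in `N` for large `n` and `w`
near `z`; let `n → ∞` with `w` fixed. -/
lemma continuousAt (h : ContinuouslyConvergesOn F g D) (hD : IsOpen D) {z : ℂ} (hz : z ∈ D) :
    ContinuousAt g z := by
  refine (closed_nhds_basis (g z)).tendsto_right_iff.2 ?_
  rintro N ⟨hN, hNc⟩
  have h1 : ∀ᶠ p in 𝓝 z ×ˢ atTop, F p.2 p.1 ∈ N :=
    (eventually_swap_iff (p := fun p : ℕ × ℂ => F p.1 p.2 ∈ N)).1 ((h z hz).eventually hN)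
  filter_upwards [h1.curry, hD.mem_nhds hz] with w hw hwD
  exact hNc.mem_of_tendsto (h.tendsto_comp hwD tendsto_id tendsto_const_nhds) hw

/-- Near `z` and for large `n` the values avoid `∞`, so the finite parts are holomorphic and
converge locally uniformly, and Weierstrass' theorem applies. -/
lemma sphericallyAnalyticAt_of_ne_infty (h : ContinuouslyConvergesOn F g D) (hD : IsOpen D)
    (hF : ∀ n, ∀ z ∈ D, SphericallyAnalyticAt (F n) z) {z : ℂ} (hz : z ∈ D)
    (hg : g z ≠ OnePoint.infty) : SphericallyAnalyticAt g z := by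
  have hfin : ∀ᶠ w in 𝓝 (g z), w ≠ OnePoint.infty := isOpen_ne.mem_nhds hg
  have h1 : ∀ᶠ p in (atTop : Filter ℕ) ×ˢ 𝓝 z, F p.1 p.2 ≠ OnePoint.infty :=
    (h z hz).eventually hfin
  have h2 : ∀ᶠ w in 𝓝 z, g w ≠ OnePoint.infty := (h.continuousAt hD hz).eventually hfin
  obtain ⟨pa, hpa, pb, hpb, hp⟩ := eventually_prod_iff.1 h1
  obtain ⟨U, hU, hUo, hzU⟩ := eventually_nhds_iff.1 (hpb.and (h2.and (hD.mem_nhds hz)))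
  have hlim : TendstoLocallyUniformlyOn (fun n w => finitePart (F n w))
      (fun w => finitePart (g w)) atTop U := by
    rw [tendstoLocallyUniformlyOn_iff_forall_tendsto]
    intro w hw
    have hc := continuousAt_finitePart (hU w hw).2.1
    have t1 : Tendsto (fun p : ℕ × ℂ => finitePart (F p.1 p.2)) (atTop ×ˢ 𝓝[U] w)
        (𝓝 (finitePart (g w))) :=
      hc.tendsto.comp ((h w (hU w hw).2.2).mono_left
        (Filter.prod_mono le_rfl nhdsWithin_le_nhds))
    have t2 : Tendsto (fun p : ℕ × ℂ => finitePart (g p.2)) (atTop ×ˢ 𝓝[U] w)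
        (𝓝 (finitePart (g w))) :=
      (hc.tendsto.comp (h.continuousAt hD (hU w hw).2.2)).comp
        (tendsto_snd.mono_right nhdsWithin_le_nhds)
    exact (t2.prodMk_nhds t1).mono_right (nhds_le_uniformity _)
  have hd : DifferentiableOn ℂ (fun w => finitePart (g w)) U := by
    refine hlim.differentiableOn ?_ hUo
    filter_upwards [hpa] with n hn w hw
    exact ((hF n w (hU w hw).2.2).analyticAt_finitePart
      (hp hn (hU w hw).1)).differentiableAt.differentiableWithinAt
  refine ⟨_, hd.analyticAt (hUo.mem_nhds hzU), Or.inl ?_⟩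
  filter_upwards [h2] with w hw
  exact (coe_finitePart hw).symm

lemma sphericallyAnalyticAt (h : ContinuouslyConvergesOn F g D) (hD : IsOpen D)
    (hF : ∀ n, ∀ z ∈ D, SphericallyAnalyticAt (F n) z) {z : ℂ} (hz : z ∈ D) :
    SphericallyAnalyticAt g z := by
  by_cases hg : g z = OnePoint.infty
  · have := (h.sphInv_comp.sphericallyAnalyticAt_of_ne_infty hD
      (fun n z hz => (hF n z hz).sphInv_comp) hz (by simp [hg])).sphInv_comp
    simpa using this
  · exact h.sphericallyAnalyticAt_of_ne_infty hD hF hz hg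

end ContinuouslyConvergesOn

/-- At each `w` near `z`, including `z`, both `f w` and `H w` are the limit of `g` along the
punctured neighbourhood of `w`. -/
lemma eventually_eq_of_tendsto_punctured {g : ℂ → OnePoint ℂ} {f H : ℂ → OnePoint ℂ} {z : ℂ}
    (hf : ∀ᶠ w in 𝓝 z, Tendsto g (𝓝[≠] w) (𝓝 (f w))) (hH : ∀ᶠ w in 𝓝 z, ContinuousAt H w)
    (hgH : ∀ᶠ w in 𝓝[≠] z, g w = H w) : ∀ᶠ w in 𝓝 z, f w = H w := by
  rw [eventually_nhdsWithin_iff] at hgH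
  filter_upwards [hf, hH, hgH.eventually_nhds] with w h1 h2 h3
  refine tendsto_nhds_unique h1 ((h2.tendsto.mono_left nhdsWithin_le_nhds).congr' ?_)
  have h4 : ∀ᶠ x in 𝓝[≠] w, x ≠ z := eventually_nhdsNE_ne w z
  filter_upwards [h4, h3.filter_mono nhdsWithin_le_nhds] with x hx1 hx2
  exact (hx2 hx1).symm

lemma isOpen_unitDisc : IsOpen unitDisc := isOpen_lt continuous_norm continuous_const

/-- The chart function is the normal form of `g` where its order is nonnegative, and that of `g⁻¹`
at a pole. -/
lemma IsMeromorphicOnDisc.sphericallyAnalyticAt {f : ℂ → OnePoint ℂ} (hf : IsMeromorphicOnDisc f)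
    {z : ℂ} (hz : z ∈ unitDisc) : SphericallyAnalyticAt f z := by
  obtain ⟨g, hg, hlim⟩ := hf
  have hlim' : ∀ᶠ w in 𝓝 z, Tendsto (fun w => (g w : OnePoint ℂ)) (𝓝[≠] w) (𝓝 (f w)) := by
    filter_upwards [isOpen_unitDisc.mem_nhds hz] with w hw using hlim w hw
  have hgm := hg z hz
  by_cases h0 : 0 ≤ meromorphicOrderAt g z
  · have ha := hgm.meromorphicOrderAt_nonneg_iff_analyticAt_toMeromorphicNFAt.1 h0
    refine ⟨_, ha, Or.inl (eventually_eq_of_tendsto_punctured hlim' ?_ ?_)⟩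
    · exact ha.eventually_analyticAt.mono fun w hw =>
        OnePoint.continuous_coe.continuousAt.comp hw.continuousAt
    · exact hgm.eq_nhdsNE_toMeromorphicNFAt.mono fun w hw => by rw [hw]
  · have h1 : 0 ≤ meromorphicOrderAt g⁻¹ z := by
      rw [meromorphicOrderAt_inv]
      push Not at h0
      lift meromorphicOrderAt g z to ℤ using ne_top_of_lt h0 with n
      norm_cast at h0 ⊢
      omega
    have hne : ∀ᶠ w in 𝓝[≠] z, g w ≠ 0 := by
      have := tendsto_norm_cobounded_atTop.comp
        (tendsto_cobounded_of_meromorphicOrderAt_neg (not_le.1 h0))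
      filter_upwards [this.eventually (eventually_gt_atTop 0)] with w hw
      simpa using hw
    have ha := hgm.inv.meromorphicOrderAt_nonneg_iff_analyticAt_toMeromorphicNFAt.1 h1
    refine ⟨_, ha, Or.inr (eventually_eq_of_tendsto_punctured hlim' ?_ ?_)⟩
    · exact ha.eventually_analyticAt.mono fun w hw =>
        continuous_sphInv.continuousAt.comp
          (OnePoint.continuous_coe.continuousAt.comp hw.continuousAt)
    · filter_upwards [hgm.inv.eq_nhdsNE_toMeromorphicNFAt, hne] with w hw hw0
      rw [← hw, Pi.inv_apply, sphInv_coe (inv_ne_zero hw0), inv_inv]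

/-! ### The spherical metric and the topology of the extended plane -/

/-- A continuous embedding of the extended plane, Lipschitz for the spherical metric. -/
noncomputable def sphereEmb : OnePoint ℂ → ℂ × ℝ
  | OnePoint.some z => (((1 + ‖z‖ ^ 2)⁻¹ : ℝ) • z, (1 + ‖z‖ ^ 2)⁻¹)
  | OnePoint.infty => (0, 0)

lemma sphereEmb_coe (z : ℂ) :
    sphereEmb (z : OnePoint ℂ) = (((1 + ‖z‖ ^ 2)⁻¹ : ℝ) • z, (1 + ‖z‖ ^ 2)⁻¹) := rfl

lemma sphereEmb_infty : sphereEmb OnePoint.infty = 0 := rfl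

lemma continuous_sphereEmb : Continuous sphereEmb := by
  rw [OnePoint.continuous_iff]
  constructor
  · rw [coclosedCompact_eq_cocompact, ← Metric.cobounded_eq_cocompact, sphereEmb_infty]
    have hn : Tendsto (fun z : ℂ => ‖z‖) (Bornology.cobounded ℂ) atTop :=
      tendsto_norm_cobounded_atTop
    have h1 : Tendsto (fun z : ℂ => ‖z‖⁻¹) (Bornology.cobounded ℂ) (𝓝 0) :=
      tendsto_inv_atTop_zero.comp hn
    refine squeeze_zero_norm' ?_ h1
    filter_upwards [hn.eventually (eventually_ge_atTop 1)] with z hz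
    have hp : 0 < 1 + ‖z‖ ^ 2 := by positivity
    have hz0 : 0 < ‖z‖ := by linarith
    rw [sphereEmb_coe, Prod.norm_def]
    refine max_le ?_ ?_
    · rw [norm_smul, Real.norm_of_nonneg (by positivity), inv_mul_le_iff₀ hp,
        ← div_eq_mul_inv, le_div_iff₀ hz0]
      nlinarith
    · rw [Real.norm_of_nonneg (by positivity)]
      exact inv_anti₀ hz0 (by nlinarith)
  · have hp : ∀ z : ℂ, 1 + ‖z‖ ^ 2 ≠ 0 := fun z => by positivity
    simp only [sphereEmb_coe]
    have : Continuous fun z : ℂ => (1 + ‖z‖ ^ 2)⁻¹ := Continuous.inv₀ (by fun_prop) hp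
    exact (this.smul continuous_id).prodMk this

lemma sphereEmb_injective : Function.Injective sphereEmb := by
  have hp : ∀ z : ℂ, (1 + ‖z‖ ^ 2)⁻¹ ≠ 0 := fun z => by positivity
  intro a b hab
  induction a using OnePoint.rec with
  | infty =>
    induction b using OnePoint.rec with
    | infty => rfl
    | coe b => exact absurd (congrArg Prod.snd hab).symm (hp b)
  | coe a =>
    induction b using OnePoint.rec with
    | infty => exact absurd (congrArg Prod.snd hab) (hp a)
    | coe b =>
      simp only [sphereEmb_coe, Prod.mk.injEq] at hab
      rw [← hab.2] at hab
      exact congrArg _ (smul_right_injective ℂ (hp a) hab.1)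

lemma isInducing_sphereEmb : IsInducing sphereEmb :=
  (continuous_sphereEmb.isClosedEmbedding sphereEmb_injective).isInducing

lemma norm_sphereEmb_coe_le (z : ℂ) :
    ‖sphereEmb (z : OnePoint ℂ)‖ ≤ 2 / Real.sqrt (1 + ‖z‖ ^ 2) := by
  have hp : 0 < 1 + ‖z‖ ^ 2 := by positivity
  have hs : 0 < Real.sqrt (1 + ‖z‖ ^ 2) := Real.sqrt_pos.2 hp
  have h2 := Real.sq_sqrt hp.le
  rw [sphereEmb_coe, Prod.norm_def]
  refine max_le ?_ ?_
  · rw [norm_smul, Real.norm_of_nonneg (by positivity), inv_mul_le_iff₀ hp, ← mul_div_assoc,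
      le_div_iff₀ hs]
    have : ‖z‖ ≤ Real.sqrt (1 + ‖z‖ ^ 2) := Real.le_sqrt_of_sq_le (by linarith)
    nlinarith [norm_nonneg z]
  · rw [Real.norm_of_nonneg (by positivity), inv_eq_one_div, div_le_div_iff₀ hp hs]
    nlinarith [norm_nonneg z]

lemma dist_sphereEmb_coe_coe_le (a b : ℂ) : dist (sphereEmb (a : OnePoint ℂ)) (sphereEmb b) ≤
    2 * ‖a - b‖ / (Real.sqrt (1 + ‖a‖ ^ 2) * Real.sqrt (1 + ‖b‖ ^ 2)) := by
  have hpa : 0 < 1 + ‖a‖ ^ 2 := by positivity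
  have hpb : 0 < 1 + ‖b‖ ^ 2 := by positivity
  set s := Real.sqrt (1 + ‖a‖ ^ 2) * Real.sqrt (1 + ‖b‖ ^ 2) with hs
  have hs0 : 0 < s := mul_pos (Real.sqrt_pos.2 hpa) (Real.sqrt_pos.2 hpb)
  have hs2 : (1 + ‖a‖ ^ 2) * (1 + ‖b‖ ^ 2) = s ^ 2 := by
    rw [hs, mul_pow, Real.sq_sqrt hpa.le, Real.sq_sqrt hpb.le]
  have hsum : ‖a‖ + ‖b‖ ≤ s := by
    refine abs_le_of_sq_le_sq' ?_ hs0.le |>.2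
    nlinarith [sq_nonneg (1 - ‖a‖ * ‖b‖)]
  have hprod : 1 + ‖a‖ * ‖b‖ ≤ s := by
    refine abs_le_of_sq_le_sq' ?_ hs0.le |>.2
    nlinarith [sq_nonneg (‖a‖ - ‖b‖)]
  have hd := norm_nonneg (a - b)
  have hsub : |‖b‖ - ‖a‖| ≤ ‖a - b‖ := by
    rw [norm_sub_rev]; exact abs_norm_sub_norm_le b a
  rw [dist_eq_norm, sphereEmb_coe, sphereEmb_coe, Prod.mk_sub_mk, Prod.norm_def]
  refine max_le ?_ ?_
  · have hA : (1 + (‖a‖ : ℂ) ^ 2) ≠ 0 := by exact_mod_cast hpa.ne'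
    have hB : (1 + (‖b‖ : ℂ) ^ 2) ≠ 0 := by exact_mod_cast hpb.ne'
    have ha2 : (‖a‖ : ℂ) ^ 2 = a * (starRingEnd ℂ) a := (Complex.mul_conj' a).symm
    have hb2 : (‖b‖ : ℂ) ^ 2 = b * (starRingEnd ℂ) b := (Complex.mul_conj' b).symm
    have key : (((1 + ‖a‖ ^ 2)⁻¹ : ℝ) • a - ((1 + ‖b‖ ^ 2)⁻¹ : ℝ) • b : ℂ) =
        ((s ^ 2)⁻¹ : ℝ) • ((a - b) - a * b * (starRingEnd ℂ) (a - b)) := by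
      rw [← hs2]
      simp only [Complex.real_smul]
      push_cast
      rw [map_sub]
      field_simp
      rw [ha2, hb2]
      ring
    rw [key, norm_smul, Real.norm_of_nonneg (by positivity), inv_mul_le_iff₀ (by positivity)]
    calc ‖(a - b) - a * b * (starRingEnd ℂ) (a - b)‖
        ≤ ‖a - b‖ + ‖a‖ * ‖b‖ * ‖a - b‖ := by
          refine (norm_sub_le _ _).trans_eq ?_
          rw [norm_mul, norm_mul, RCLike.norm_conj]
      _ = (1 + ‖a‖ * ‖b‖) * ‖a - b‖ := by ring
      _ ≤ s * ‖a - b‖ := by gcongr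
      _ ≤ s ^ 2 * (2 * ‖a - b‖ / s) := by
          rw [show s ^ 2 * (2 * ‖a - b‖ / s) = 2 * (s * ‖a - b‖) by field_simp]
          nlinarith [mul_nonneg hs0.le hd]
  · have key : (1 + ‖a‖ ^ 2)⁻¹ - (1 + ‖b‖ ^ 2)⁻¹ =
        (s ^ 2)⁻¹ * ((‖b‖ - ‖a‖) * (‖a‖ + ‖b‖)) := by
      rw [← hs2]
      field_simp
      ring
    rw [key, norm_mul, Real.norm_of_nonneg (by positivity), inv_mul_le_iff₀ (by positivity),
      norm_mul, Real.norm_eq_abs, Real.norm_of_nonneg (by positivity)]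
    calc |‖b‖ - ‖a‖| * (‖a‖ + ‖b‖) ≤ ‖a - b‖ * s := by gcongr
      _ ≤ s ^ 2 * (2 * ‖a - b‖ / s) := by
          rw [show s ^ 2 * (2 * ‖a - b‖ / s) = 2 * (s * ‖a - b‖) by field_simp]
          nlinarith [mul_nonneg hs0.le hd]

/-- `sphereEmb` is stereographic projection onto a sphere of diameter `1` through the origin, the
image of `∞`. Since it induces the topology of `OnePoint ℂ`, this one-sided bound is enough to turn
spherical convergence into topological convergence. -/
lemma dist_sphereEmb_le (a b : OnePoint ℂ) :
    dist (sphereEmb a) (sphereEmb b) ≤ sphericalDist a b := by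
  induction a using OnePoint.rec with
  | infty =>
    induction b using OnePoint.rec with
    | infty => simp [sphericalDist]
    | coe b =>
      rw [dist_comm, sphereEmb_infty, dist_zero_right]
      exact norm_sphereEmb_coe_le b
  | coe a =>
    induction b using OnePoint.rec with
    | infty =>
      rw [sphereEmb_infty, dist_zero_right]
      exact norm_sphereEmb_coe_le a
    | coe b => exact dist_sphereEmb_coe_coe_le a b

/-- Continuity of `g` is not assumed: it follows from locally uniform convergence, and then upgrades
it to joint convergence in `(n, z)`. -/
lemma TendstoSphericallyOnCompacts.continuouslyConvergesOn {F : ℕ → ℂ → OnePoint ℂ}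
    {g : ℂ → OnePoint ℂ} (h : TendstoSphericallyOnCompacts F g)
    (hF : ∀ n, ∀ z ∈ unitDisc, ContinuousAt (F n) z) :
    ContinuouslyConvergesOn F g unitDisc := by
  have hloc : TendstoLocallyUniformlyOn (fun n z => sphereEmb (F n z))
      (fun z => sphereEmb (g z)) atTop unitDisc := by
    rw [tendstoLocallyUniformlyOn_iff_forall_isCompact isOpen_unitDisc]
    intro K hKD hK
    rw [Metric.tendstoUniformlyOn_iff]
    intro ε hε
    obtain ⟨N, hN⟩ := h K hK hKD ε hε
    filter_upwards [eventually_ge_atTop N] with n hn z hz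
    rw [dist_comm]
    exact (dist_sphereEmb_le _ _).trans_lt (hN n hn z hz)
  have hcont : ContinuousOn (fun z => sphereEmb (g z)) unitDisc := by
    refine hloc.continuousOn (Frequently.of_forall fun n z hz => ?_)
    exact (continuous_sphereEmb.continuousAt.comp (hF n z hz)).continuousWithinAt
  intro z hz
  rw [isInducing_sphereEmb.tendsto_nhds_iff]
  have h1 := tendstoLocallyUniformlyOn_iff_forall_tendsto.1 hloc z hz
  rw [isOpen_unitDisc.nhdsWithin_eq hz] at h1
  have h2 : Tendsto (fun p : ℕ × ℂ => sphereEmb (g p.2)) (atTop ×ˢ 𝓝 z) (𝓝 (sphereEmb (g z))) :=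
    (hcont.continuousAt (isOpen_unitDisc.mem_nhds hz)).tendsto.comp tendsto_snd
  exact h2.congr_uniformity h1

/-! ### Normal maps of the upper half-plane along a curve tending to infinity -/

/-- The open upper half-plane, as a set. -/
def upperHalf : Set ℂ := {w | 0 < w.im}

lemma mem_upperHalf {w : ℂ} : w ∈ upperHalf ↔ 0 < w.im := Iff.rfl

lemma isOpen_upperHalf : IsOpen upperHalf := isOpen_lt continuous_const Complex.continuous_im

lemma isPreconnected_upperHalf : IsPreconnected upperHalf :=
  (convex_halfSpace_im_gt 0).isPreconnected

lemma I_mem_upperHalf : Complex.I ∈ upperHalf := by simp [upperHalf]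

/-- Normality with respect to the real affine automorphisms of the upper half-plane. -/
def IsAffineNormal (F : ℂ → OnePoint ℂ) : Prop :=
  ∀ s x : ℕ → ℝ, (∀ n, 0 < s n) → ∃ k : ℕ → ℕ, StrictMono k ∧ ∃ g : ℂ → OnePoint ℂ,
    ContinuouslyConvergesOn (fun n w => F (s (k n) * w + x (k n))) g upperHalf

/-- A normal sphere-valued holomorphic map `F` of the upper half-plane with limit `c` along a
connected set `C` which goes to infinity tangentially to the real line, on the side given by the
sign `σ`. -/
structure HasTangentialLimit (F : ℂ → OnePoint ℂ) (C : Set ℂ) (σ : ℝ) (c : OnePoint ℂ) :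
    Prop where
  analytic : ∀ w ∈ upperHalf, SphericallyAnalyticAt F w
  normal : IsAffineNormal F
  subset : C ⊆ upperHalf
  isPreconnected : IsPreconnected C
  unbounded : ∀ R : ℝ, ∃ w ∈ C, R ≤ ‖w‖
  limit : ∀ O ∈ 𝓝 c, ∃ R : ℝ, ∀ w ∈ C, R ≤ ‖w‖ → F w ∈ O
  slope : ∀ ε > 0, ∃ R : ℝ, ∀ w ∈ C, R ≤ ‖w‖ → w.im ≤ ε * (σ * w.re)
  sign : σ = 1 ∨ σ = -1

namespace HasTangentialLimit

variable {F : ℂ → OnePoint ℂ} {C : Set ℂ} {σ : ℝ} {c : OnePoint ℂ}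

lemma sphInv_comp (h : HasTangentialLimit F C σ c) :
    HasTangentialLimit (fun w => sphInv (F w)) C σ (sphInv c) where
  analytic w hw := (h.analytic w hw).sphInv_comp
  normal s x hs := by
    obtain ⟨k, hk, g, hg⟩ := h.normal s x hs
    exact ⟨k, hk, _, hg.sphInv_comp⟩
  subset := h.subset
  isPreconnected := h.isPreconnected
  unbounded := h.unbounded
  limit O hO := h.limit _ (continuous_sphInv.continuousAt hO)
  slope := h.slope
  sign := h.sign

lemma exists_limit (h : HasTangentialLimit F C σ c) {s x : ℕ → ℝ} (hs : ∀ n, 0 < s n) :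
    ∃ k : ℕ → ℕ, StrictMono k ∧ ∃ g : ℂ → OnePoint ℂ,
      ContinuouslyConvergesOn (fun n w => F (s (k n) * w + x (k n))) g upperHalf ∧
      ∀ w ∈ upperHalf, SphericallyAnalyticAt g w := by
  obtain ⟨k, hk, g, hg⟩ := h.normal s x hs
  refine ⟨k, hk, g, hg, fun w hw => hg.sphericallyAnalyticAt isOpen_upperHalf ?_ hw⟩
  intro n z hz
  refine SphericallyAnalyticAt.comp (φ := fun w => s (k n) * w + x (k n)) (h.analytic _ ?_)
    (by fun_prop)
  simpa [upperHalf] using mul_pos (hs (k n)) hz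

lemma exists_mem_norm_sub_eq (h : HasTangentialLimit F C σ c) {p q : ℂ} (hq : q ∈ C) {t : ℝ}
    (ht : ‖q - p‖ ≤ t) : ∃ w ∈ C, ‖w - p‖ = t := by
  obtain ⟨w, hw, hwn⟩ := h.unbounded (‖p‖ + t)
  have h1 : t ≤ ‖w - p‖ := by linarith [norm_sub_norm_le w p]
  obtain ⟨v, hv, hvt⟩ := h.isPreconnected.intermediate_value hq hw
    (f := fun w => ‖w - p‖) (by fun_prop) ⟨ht, h1⟩
  exact ⟨v, hv, hvt⟩

lemma eventually_mem_of_compact (h : HasTangentialLimit F C σ c) {K : Set ℂ} (hK : IsCompact K)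
    (hKH : K ⊆ upperHalf) {O : Set (OnePoint ℂ)} (hO : O ∈ 𝓝 c) :
    ∃ R : ℝ, ∀ q ∈ C, R ≤ ‖q‖ → ∀ v ∈ K, F (q.im * v + q.re) ∈ O := by
  by_contra! hcon
  choose q hqC hqn v hvK hv using fun n : ℕ => hcon n
  have hqim : ∀ n, 0 < (q n).im := fun n => h.subset (hqC n)
  have hqtop : Tendsto (fun n => ‖q n‖) atTop atTop :=
    tendsto_atTop_mono hqn tendsto_natCast_atTop_atTop
  obtain ⟨k, hk, g, hg, hga⟩ := h.exists_limit (s := fun n => (q n).im) (x := fun n => (q n).re) hqim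
  -- In the coordinate taking `q n` to `i`, the connected unbounded set `C` crosses the circle of
  -- radius `s`. As `s < 1`, the crossing points `p n` still tend to infinity, so `F (p n) → c`.
  have hsphere : ∀ s ∈ Ioo (0 : ℝ) 1, ∃ u ∈ Metric.sphere Complex.I s, g u = c := by
    intro s hs
    have hex : ∀ n, ∃ p ∈ C, ‖p - q n‖ = s * (q n).im := fun n =>
      h.exists_mem_norm_sub_eq (hqC n) (by simpa using mul_nonneg hs.1.le (hqim n).le)
    choose p hpC hp using hex
    have hpn : Tendsto (fun n => ‖p n‖) atTop atTop := by
      refine tendsto_atTop_mono (fun n => ?_) (hqtop.const_mul_atTop (sub_pos.2 hs.2))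
      have h1 := norm_sub_norm_le (q n) (p n)
      rw [norm_sub_rev, hp] at h1
      have h2 : s * (q n).im ≤ s * ‖q n‖ :=
        mul_le_mul_of_nonneg_left ((le_abs_self _).trans (Complex.abs_im_le_norm _)) hs.1.le
      linarith
    have hFp : Tendsto (fun n => F (p n)) atTop (𝓝 c) := by
      intro O' hO'
      obtain ⟨R, hR⟩ := h.limit O' hO'
      exact (hpn.eventually (eventually_ge_atTop R)).mono fun n hn => hR _ (hpC n) hn
    set u : ℕ → ℂ := fun n => (p n - (q n).re) / (q n).im with hu
    have hne : ∀ n, ((q n).im : ℂ) ≠ 0 := fun n => by exact_mod_cast (hqim n).ne'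
    have hup : ∀ n, (q n).im * u n + (q n).re = p n := fun n => by
      rw [hu]; field_simp [hne n]; ring
    have hus : ∀ n, u n ∈ Metric.sphere Complex.I s := by
      intro n
      have h1 : u n - Complex.I = (p n - q n) / (q n).im := by
        rw [hu, eq_div_iff (hne n), sub_mul, div_mul_cancel₀ _ (hne n)]
        nth_rewrite 3 [← Complex.re_add_im (q n)]
        ring
      rw [mem_sphere_iff_norm, h1, norm_div, hp, Complex.norm_real,
        Real.norm_of_nonneg (hqim n).le, mul_div_cancel_right₀ _ (hqim n).ne']
    obtain ⟨u₀, hu₀, m, hm, hlim⟩ :=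
      (isCompact_sphere Complex.I s).tendsto_subseq (fun n => hus (k n))
    refine ⟨u₀, hu₀, ?_⟩
    have hu₀H : u₀ ∈ upperHalf := by
      rw [mem_sphere_iff_norm] at hu₀
      have := (Complex.abs_im_le_norm (u₀ - Complex.I)).trans_eq hu₀
      rw [Complex.sub_im, Complex.I_im] at this
      change 0 < u₀.im
      linarith [(abs_le.1 this).1, hs.2]
    have h1 := hg.tendsto_comp hu₀H hm.tendsto_atTop hlim
    have h2 : Tendsto (fun n => F (p (k (m n)))) atTop (𝓝 c) :=
      hFp.comp (hk.tendsto_atTop.comp hm.tendsto_atTop)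
    refine tendsto_nhds_unique h1 (h2.congr fun n => ?_)
    simp only [Function.comp]
    rw [hup]
  have hgc : ∀ z ∈ upperHalf, g z = c := by
    refine eqOn_const_of_frequently_eq isPreconnected_upperHalf hga I_mem_upperHalf ?_
    rw [frequently_nhdsWithin_iff, Metric.nhds_basis_ball.frequently_iff]
    intro ε hε
    obtain ⟨u, hu, huc⟩ := hsphere (min (ε / 2) (1 / 2)) ⟨by positivity, by
      exact (min_le_right _ _).trans_lt (by norm_num)⟩
    rw [Metric.mem_sphere] at hu
    refine ⟨u, ?_, huc, ?_⟩
    · rw [Metric.mem_ball, hu]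
      exact (min_le_left _ _).trans_lt (by linarith)
    · rintro rfl
      rw [dist_self] at hu
      exact absurd hu (by positivity)
  obtain ⟨v₀, hv₀, m, hm, hlim⟩ := hK.tendsto_subseq (fun n => hvK (k n))
  have h1 := hg.tendsto_comp (hKH hv₀) hm.tendsto_atTop hlim
  rw [hgc v₀ (hKH hv₀)] at h1
  obtain ⟨n, hn⟩ := (h1.eventually hO).exists
  exact hv _ hn

end HasTangentialLimit

/-! ### Points of small slope: the lowest bad point and the two-constants estimate. -/

/-- A two-constants estimate in the box `|Re v| < 1`, `Im v < 1 / 2`. -/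
lemma norm_le_of_box {W : Set ℂ} {G : ℂ → ℂ} {η κ : ℝ} (hκ : 0 ≤ κ) (hη : 0 ≤ η)
    (hW : closure W ⊆ upperHalf)
    (hG : ∀ v ∈ closure W, |v.re| ≤ 1 → v.im ≤ 1 / 2 → DifferentiableAt ℂ G v ∧ ‖G v‖ ≤ η)
    (hfr : ∀ v ∈ frontier W, |v.re| ≤ 1 → v.im ≤ 1 / 2 → ‖G v‖ ≤ η * Real.exp (-κ))
    {v : ℂ} (hv : v ∈ W) (hre : |v.re| < 1) (him : v.im < 1 / 2) :
    ‖G v‖ ≤ η * Real.exp (-κ * (1 - (8 / 3 * v.im + 4 / 3 * (v.re ^ 2 - v.im ^ 2)))) := by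
  set B : Set ℂ := {v | |v.re| < 1 ∧ v.im < 1 / 2} with hB
  have hBc : closure B ⊆ {v | |v.re| ≤ 1 ∧ v.im ≤ 1 / 2} := by
    refine closure_minimal (fun v hv => ⟨hv.1.le, hv.2.le⟩) ?_
    exact (isClosed_le Complex.continuous_re.abs continuous_const).inter
      (isClosed_le Complex.continuous_im continuous_const)
  have hBo : IsOpen B := (isOpen_lt Complex.continuous_re.abs continuous_const).inter
    (isOpen_lt Complex.continuous_im continuous_const)
  have hcl : ∀ v ∈ closure (W ∩ B), v ∈ closure W ∧ |v.re| ≤ 1 ∧ v.im ≤ 1 / 2 := fun v hv =>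
    ⟨closure_mono inter_subset_left hv, hBc (closure_mono inter_subset_right hv)⟩
  -- With `v = x + iy`, `‖E v‖ = exp (κ (1 - u))` for the harmonic `u = 8/3 y + 4/3 (x² - y²)`. In
  -- the box `u ≥ 0`, while `u ≥ 1` on the sides `|x| = 1` and the top `y = 1/2`. Hence `‖G E‖ ≤ η`
  -- on the whole frontier, and the maximum principle applies.
  set E : ℂ → ℂ := fun v => Complex.exp (κ * (1 + 8 / 3 * (Complex.I * v) - 4 / 3 * v ^ 2)) with hE
  have hEn : ∀ v, ‖E v‖ = Real.exp (κ * (1 - (8 / 3 * v.im + 4 / 3 * (v.re ^ 2 - v.im ^ 2)))) := by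
    intro v
    rw [hE, Complex.norm_exp]
    congr 1
    rw [Complex.re_ofReal_mul]
    congr 1
    have e1 : (8 / 3 : ℂ) = ((8 / 3 : ℝ) : ℂ) := by norm_num
    have e2 : (4 / 3 : ℂ) = ((4 / 3 : ℝ) : ℂ) := by norm_num
    rw [e1, e2, Complex.sub_re, Complex.add_re, Complex.re_ofReal_mul, Complex.re_ofReal_mul,
      Complex.one_re, Complex.I_mul_re, pow_two, Complex.mul_re]
    ring
  have hbdd : Bornology.IsBounded (W ∩ B) := by
    refine (Metric.isBounded_closedBall (x := (0 : ℂ)) (r := 2)).subset fun v hv => ?_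
    rw [mem_closedBall_zero_iff]
    have h0 : 0 < v.im := hW (subset_closure hv.1)
    have := Complex.norm_le_abs_re_add_abs_im v
    rw [abs_of_pos h0] at this
    linarith [hv.2.1, hv.2.2]
  have hdiff : DiffContOnCl ℂ (fun v => G v * E v) (W ∩ B) := by
    have hd : ∀ v ∈ closure (W ∩ B), DifferentiableAt ℂ (fun v => G v * E v) v := fun v hv => by
      obtain ⟨h1, h2, h3⟩ := hcl v hv
      exact (hG v h1 h2 h3).1.mul (by fun_prop)
    exact ⟨fun v hv => (hd v (subset_closure hv)).differentiableWithinAt,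
      fun v hv => (hd v hv).continuousAt.continuousWithinAt⟩
  have hbound : ∀ v ∈ frontier (W ∩ B), ‖G v * E v‖ ≤ η := by
    intro v hv
    obtain ⟨h1, h2, h3⟩ := hcl v (frontier_subset_closure hv)
    have h0 : 0 < v.im := hW h1
    rw [norm_mul, hEn]
    rcases frontier_inter_subset W B hv with ⟨hvW, -⟩ | ⟨-, hvB⟩
    · calc ‖G v‖ * _ ≤ (η * Real.exp (-κ)) * Real.exp κ := by
            refine mul_le_mul (hfr v hvW h2 h3) (Real.exp_le_exp.2 ?_) (by positivity)
              (by positivity)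
            refine mul_le_of_le_one_right hκ ?_
            nlinarith [sq_nonneg v.re]
        _ = η := by rw [mul_assoc, ← Real.exp_add]; simp
    · have hside : |v.re| = 1 ∨ v.im = 1 / 2 := by
        by_contra! hne
        rw [hBo.frontier_eq] at hvB
        exact hvB.2 ⟨lt_of_le_of_ne h2 hne.1, lt_of_le_of_ne h3 hne.2⟩
      calc ‖G v‖ * _ ≤ η * 1 := by
            refine mul_le_mul (hG v h1 h2 h3).2 ?_ (by positivity) hη
            rw [Real.exp_le_one_iff]
            refine mul_nonpos_of_nonneg_of_nonpos hκ ?_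
            rcases hside with hs | hs
            · have : v.re ^ 2 = 1 := by rw [← sq_abs, hs, one_pow]
              rw [this]; nlinarith
            · rw [hs]; nlinarith [sq_nonneg v.re]
        _ = η := mul_one η
  have := Complex.norm_le_of_forall_mem_frontier_norm_le hbdd hdiff hbound
    (subset_closure ⟨hv, hre, him⟩)
  rw [norm_mul, hEn] at this
  rw [neg_mul, Real.exp_neg, ← div_eq_mul_inv, le_div_iff₀ (Real.exp_pos _)]
  exact this

lemma IsPreconnected.subset_of_disjoint_frontier {α : Type*} [TopologicalSpace α] {s u : Set α}
    (hs : IsPreconnected s) (hu : IsOpen u) (hne : (s ∩ u).Nonempty)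
    (hd : ∀ x ∈ s, x ∉ frontier u) : s ⊆ u := by
  refine hs.subset_of_closure_inter_subset hu hne fun x hx => ?_
  by_contra hxu
  exact hd x hx.2 (by rw [hu.frontier_eq]; exact ⟨hx.1, hxu⟩)

/-- The point `w` minimises `Im p + k |Re p - Re z|` over the bad points. The penalty makes the
sublevel set bounded, and `closure U ⊆ upperHalf` makes it closed. By the triangle inequality,
minimality leaves a downward cone at `w` free of bad points. -/
lemma exists_lowest_bad_point {F : ℂ → OnePoint ℂ} (hF : ContinuousOn F upperHalf) {U : Set ℂ}
    (hU : closure U ⊆ upperHalf) {k : ℝ} (hk : 0 < k) {O : Set (OnePoint ℂ)} (hO : IsOpen O)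
    {z : ℂ} (hz : z ∈ U) (hzO : F z ∉ O) :
    ∃ w ∈ closure U, F w ∉ O ∧ w.im + k * |w.re - z.re| ≤ z.im ∧
      ∀ p ∈ closure U, F p ∉ O → w.im - k * |p.re - w.re| ≤ p.im := by
  have hΦ : Continuous fun p : ℂ => p.im + k * |p.re - z.re| := by
    have := Complex.continuous_re
    have := Complex.continuous_im
    fun_prop
  set S : Set ℂ := closure U ∩ F ⁻¹' Oᶜ ∩ {p | p.im + k * |p.re - z.re| ≤ z.im} with hS
  have hclosed : IsClosed S :=
    ((hF.mono hU).preimage_isClosed_of_isClosed isClosed_closure hO.isClosed_compl).inter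
      (isClosed_le hΦ continuous_const)
  have hbdd : Bornology.IsBounded S := by
    refine (Metric.isBounded_closedBall (x := (0 : ℂ))
      (r := |z.re| + z.im / k + z.im)).subset fun p hp => ?_
    rw [mem_closedBall_zero_iff]
    have h0 : 0 < p.im := hU hp.1.1
    have h1 : p.im + k * |p.re - z.re| ≤ z.im := hp.2
    have h2 := Complex.norm_le_abs_re_add_abs_im p
    rw [abs_of_pos h0] at h2
    have h3 : |p.re - z.re| ≤ z.im / k := by rw [le_div_iff₀ hk]; linarith
    have h4 : p.im ≤ z.im := by nlinarith [abs_nonneg (p.re - z.re)]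
    linarith [abs_sub_abs_le_abs_sub p.re z.re]
  have hzS : z ∈ S := ⟨⟨subset_closure hz, hzO⟩, by simp⟩
  obtain ⟨w, hw, hmin⟩ := (Metric.isCompact_of_isClosed_isBounded hclosed hbdd).exists_isMinOn
    ⟨z, hzS⟩ hΦ.continuousOn
  refine ⟨w, hw.1.1, hw.1.2, hw.2, fun p hp hpO => ?_⟩
  have h1 : w.im + k * |w.re - z.re| ≤ p.im + k * |p.re - z.re| := by
    by_cases hpS : p.im + k * |p.re - z.re| ≤ z.im
    · exact hmin (show p ∈ S from ⟨⟨hp, hpO⟩, hpS⟩)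
    · have : w.im + k * |w.re - z.re| ≤ z.im := hw.2
      linarith
  have h2 : |p.re - z.re| ≤ |p.re - w.re| + |w.re - z.re| := abs_sub_le _ _ _
  nlinarith [mul_le_mul_of_nonneg_left h2 hk.le]

/-- The box below the lowest bad point must be far out and of slope at most `k`, where the frontier
is known to lie on `C`. The horizontal shift from `z` to `w` is at most `Im z / k`, hence at most
`|Re z| / 4`, which is why `z` is given slope `k / 4`. -/
lemma low_box_bounds {σ k : ℝ} (hσ : σ = 1 ∨ σ = -1) (hk : 0 < k) (hk4 : k ≤ 1 / 4) {z w p : ℂ}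
    (hz : 0 < z.im) (hw : 0 < w.im) (hslope : z.im ≤ k / 4 * (σ * z.re))
    (hwz : w.im + k * |w.re - z.re| ≤ z.im) (hp : |p.re - w.re| ≤ w.im) (hpi : p.im ≤ w.im) :
    ‖z‖ / 4 ≤ ‖p‖ ∧ p.im ≤ k * (σ * p.re) := by
  have hX : 0 < σ * z.re := by
    by_contra! hneg
    nlinarith
  have habs : ∀ x : ℝ, σ * x ≤ |x| ∧ -|x| ≤ σ * x := fun x => by
    rcases hσ with rfl | rfl
    · simpa using ⟨le_abs_self x, neg_abs_le x⟩
    · simpa using ⟨neg_le_abs x, le_abs_self x⟩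
  have hzre : |z.re| = σ * z.re := by
    rcases hσ with rfl | rfl
    · rw [one_mul] at hX ⊢; exact abs_of_pos hX
    · rw [neg_one_mul] at hX ⊢; exact abs_of_neg (by linarith)
  have h1 : |w.re - z.re| ≤ σ * z.re / 4 := by
    have : k * |w.re - z.re| ≤ k * (σ * z.re / 4) := by linarith
    exact le_of_mul_le_mul_left this hk
  have h2 : w.im ≤ z.im := by nlinarith [abs_nonneg (w.re - z.re)]
  have h3 : k / 4 * (σ * z.re) ≤ 1 / 16 * (σ * z.re) :=
    mul_le_mul_of_nonneg_right (by linarith) hX.le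
  have h4 : σ * z.re / 2 ≤ σ * p.re := by
    have e : σ * p.re = σ * (p.re - w.re) + σ * (w.re - z.re) + σ * z.re := by ring
    have e1 := (habs (p.re - w.re)).2
    have e2 := (habs (w.re - z.re)).2
    linarith
  constructor
  · have h5 := Complex.norm_le_abs_re_add_abs_im z
    rw [abs_of_pos hz, hzre] at h5
    have h6 := (habs p.re).1.trans (Complex.abs_re_le_norm p)
    linarith
  · have : k * (σ * z.re / 2) ≤ k * (σ * p.re) := mul_le_mul_of_nonneg_left h4 hk.le
    nlinarith [mul_pos hk hX]

lemma image_ball_mem_nhds (c : ℂ) {ε : ℝ} (hε : 0 < ε) :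
    ((↑) : ℂ → OnePoint ℂ) '' Metric.ball c ε ∈ 𝓝 (c : OnePoint ℂ) :=
  (OnePoint.isOpen_image_coe.2 Metric.isOpen_ball).mem_nhds ⟨c, Metric.mem_ball_self hε, rfl⟩

lemma exists_image_ball_subset {c : ℂ} {O : Set (OnePoint ℂ)} (hO : O ∈ 𝓝 (c : OnePoint ℂ)) :
    ∃ ε > 0, ((↑) : ℂ → OnePoint ℂ) '' Metric.ball c ε ⊆ O := by
  obtain ⟨ε, hε, h⟩ := Metric.mem_nhds_iff.1
    (OnePoint.continuous_coe.continuousAt (x := c) hO)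
  exact ⟨ε, hε, image_subset_iff.2 h⟩

lemma mem_image_ball_iff {c : ℂ} {ε : ℝ} {w : OnePoint ℂ} :
    w ∈ ((↑) : ℂ → OnePoint ℂ) '' Metric.ball c ε ↔
      w ≠ OnePoint.infty ∧ ‖finitePart w - c‖ < ε := by
  constructor
  · rintro ⟨z, hz, rfl⟩
    exact ⟨OnePoint.coe_ne_infty z, by simpa using mem_ball_iff_norm.1 hz⟩
  · rintro ⟨h1, h2⟩
    exact ⟨finitePart w, mem_ball_iff_norm.2 h2, coe_finitePart h1⟩

namespace HasTangentialLimit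

variable {F : ℂ → OnePoint ℂ} {C : Set ℂ} {σ : ℝ}

lemma continuousOn {c : OnePoint ℂ} (h : HasTangentialLimit F C σ c) :
    ContinuousOn F upperHalf :=
  fun w hw => (h.analytic w hw).continuousAt.continuousWithinAt

/-- Smallness of `F` at the points of a rescaled box below a lowest bad point. -/
lemma mem_ball_of_box {c : ℂ} (h : HasTangentialLimit F C σ c) {U : Set ℂ}
    (hU : closure U ⊆ upperHalf) {η κ y x t : ℝ} (hη : 0 < η) (hκ : 0 ≤ κ)
    (hy : 0 < y)
    (hgood : ∀ p ∈ closure U, |p.re - x| ≤ y → p.im ≤ y / 2 →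
      F p ∈ ((↑) : ℂ → OnePoint ℂ) '' Metric.ball c η)
    (hfr : ∀ p ∈ frontier U, |p.re - x| ≤ y → p.im ≤ y / 2 →
      F p ∈ ((↑) : ℂ → OnePoint ℂ) '' Metric.ball c (η * Real.exp (-κ)))
    (ht : t < 1 / 2) (htU : (y * (t * Complex.I) + x : ℂ) ∈ U) :
    F (y * (t * Complex.I) + x) ≠ OnePoint.infty ∧
      ‖finitePart (F (y * (t * Complex.I) + x)) - c‖ ≤
        η * Real.exp (-κ * (1 - (8 / 3 * t - 4 / 3 * t ^ 2))) := by
  set A : ℂ → ℂ := fun v => y * v + x with hA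
  have hAc : Continuous A := by fun_prop
  have hAre : ∀ v, (A v).re - x = y * v.re := fun v => by simp [hA]
  have hAim : ∀ v, (A v).im = y * v.im := fun v => by simp [hA]
  have hcl : ∀ v ∈ closure (A ⁻¹' U), A v ∈ closure U := fun v hv =>
    hAc.closure_preimage_subset U hv
  have hbox : ∀ v : ℂ, |v.re| ≤ 1 → v.im ≤ 1 / 2 → |(A v).re - x| ≤ y ∧ (A v).im ≤ y / 2 := by
    intro v h1 h2
    rw [hAre, hAim, abs_mul, abs_of_pos hy]
    exact ⟨mul_le_of_le_one_right hy.le h1, by nlinarith⟩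
  have hmem : A (t * Complex.I) ∈ U := htU
  have h0 : 0 < y * t := by
    have := hU (subset_closure hmem)
    rw [upperHalf, mem_ofPred_eq, hAim] at this
    simpa using this
  have ht0 : 0 < t := (pos_iff_pos_of_mul_pos h0).1 hy
  have hfin : F (A (t * Complex.I)) ≠ OnePoint.infty :=
    (mem_image_ball_iff.1 (hgood _ (subset_closure hmem) (by simp [hAre, hy.le])
      (by rw [hAim]; simp; nlinarith))).1
  refine ⟨hfin, ?_⟩
  have := norm_le_of_box (W := A ⁻¹' U) (G := fun v => finitePart (F (A v)) - c) (η := η) hκ hη.le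
    (fun v hv => by
      have := hU (hcl v hv)
      rw [upperHalf, mem_ofPred_eq, hAim] at this
      exact (pos_iff_pos_of_mul_pos this).1 hy)
    (fun v hv h1 h2 => by
      have hg := mem_image_ball_iff.1 (hgood _ (hcl v hv) (hbox v h1 h2).1 (hbox v h1 h2).2)
      refine ⟨?_, hg.2.le⟩
      have ha : AnalyticAt ℂ (fun v => finitePart (F (A v))) v :=
        SphericallyAnalyticAt.analyticAt_finitePart
          ((h.analytic _ (hU (hcl v hv))).comp (φ := A) (by rw [hA]; fun_prop)) hg.1
      exact ha.differentiableAt.sub_const c)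
    (fun v hv h1 h2 => (mem_image_ball_iff.1 (hfr _ (hAc.frontier_preimage_subset U hv)
      (hbox v h1 h2).1 (hbox v h1 h2).2)).2.le)
    (v := t * Complex.I) htU (by simp) (by simpa using ht)
  simpa [sub_eq_add_neg] using this

/-- Convergence at the points of small slope of domains which are bounded by the curve there. -/
lemma eventually_mem_of_low {c : ℂ} (h : HasTangentialLimit F C σ c) {k : ℝ} (hk : 0 < k)
    (hk4 : k ≤ 1 / 4) (R₀ : ℝ) {O : Set (OnePoint ℂ)} (hO : O ∈ 𝓝 (c : OnePoint ℂ)) :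
    ∃ R : ℝ, ∀ U : Set ℂ, IsOpen U → closure U ⊆ upperHalf →
      (∀ w ∈ frontier U, R₀ ≤ ‖w‖ → w.im ≤ k * (σ * w.re) → w ∈ C) →
      ∀ z ∈ U, R ≤ ‖z‖ → z.im ≤ k / 4 * (σ * z.re) → F z ∈ O := by
  obtain ⟨η, hη, hηO⟩ := exists_image_ball_subset hO
  set B : ℝ → Set (OnePoint ℂ) := fun ε => ((↑) : ℂ → OnePoint ℂ) '' Metric.ball c ε with hB
  suffices ∃ R : ℝ, ∀ U : Set ℂ, IsOpen U → closure U ⊆ upperHalf →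
      (∀ w ∈ frontier U, R₀ ≤ ‖w‖ → w.im ≤ k * (σ * w.re) → w ∈ C) →
      ∀ z ∈ U, R ≤ ‖z‖ → z.im ≤ k / 4 * (σ * z.re) → F z ∈ B η by
    obtain ⟨R, hR⟩ := this
    exact ⟨R, fun U h1 h2 h3 z h4 h5 h6 => hηO (hR U h1 h2 h3 z h4 h5 h6)⟩
  by_contra! hcon
  choose U hUo hU hfr z hzU hzn hslope hzB using fun n : ℕ => hcon n
  have hBo : IsOpen (B η) := OnePoint.isOpen_image_coe.2 Metric.isOpen_ball
  choose w hwU hwB hwz hmin using fun n =>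
    exists_lowest_bad_point h.continuousOn (hU n) hk hBo (hzU n) (hzB n)
  have hwim : ∀ n, 0 < (w n).im := fun n => hU n (hwU n)
  have hgeo : ∀ n (p : ℂ), |p.re - (w n).re| ≤ (w n).im → p.im ≤ (w n).im →
      (n : ℝ) / 4 ≤ ‖p‖ ∧ p.im ≤ k * (σ * p.re) := fun n p h1 h2 => by
    have := low_box_bounds h.sign hk hk4 (hU n (subset_closure (hzU n))) (hwim n) (hslope n)
      (hwz n) h1 h2
    exact ⟨by linarith [hzn n], this.2⟩
  have hlarge : ∀ R : ℝ, ∀ᶠ n : ℕ in atTop, ∀ p : ℂ, |p.re - (w n).re| ≤ (w n).im →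
      p.im ≤ (w n).im → R ≤ ‖p‖ := fun R => by
    filter_upwards [tendsto_natCast_atTop_atTop.eventually (eventually_ge_atTop (4 * R))]
      with n hn p h1 h2
    linarith [(hgeo n p h1 h2).1]
  have hfrC : ∀ R : ℝ, ∀ᶠ n : ℕ in atTop, ∀ p ∈ frontier (U n), |p.re - (w n).re| ≤ (w n).im →
      p.im ≤ (w n).im → p ∈ C ∧ R ≤ ‖p‖ := fun R => by
    filter_upwards [hlarge (max R R₀)] with n hn p hp h1 h2
    exact ⟨hfr n p hp ((le_max_right _ _).trans (hn p h1 h2)) (hgeo n p h1 h2).2,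
      (le_max_left _ _).trans (hn p h1 h2)⟩
  -- A bad point on the frontier would lie on `C` far out, where `F` is close to `c`.
  have hwmem : ∀ᶠ n in atTop, w n ∈ U n := by
    obtain ⟨R₁, hR₁⟩ := h.limit (B η) (image_ball_mem_nhds c hη)
    filter_upwards [hfrC R₁] with n hn
    by_contra hw
    have h1 := hn (w n) (by rw [(hUo n).frontier_eq]; exact ⟨hwU n, hw⟩)
      (by simpa using (hwim n).le) le_rfl
    exact hwB n (hR₁ _ h1.1 h1.2)
  -- The cone condition with `k ≤ 1/4` puts every bad point over this base at height at least `3/4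
  -- Im w`.
  have hgood : ∀ n, ∀ p ∈ closure (U n), |p.re - (w n).re| ≤ (w n).im → p.im ≤ (w n).im / 2 →
      F p ∈ B η := by
    intro n p hp h1 h2
    by_contra hpB
    have h3 := hmin n p hp hpB
    have h4 : k * |p.re - (w n).re| ≤ 1 / 4 * (w n).im :=
      mul_le_mul hk4 h1 (abs_nonneg _) (by norm_num)
    linarith [hwim n]
  have hcol : ∀ s ∈ Ioo (0 : ℝ) (1 / 2), ∀ᶠ n in atTop,
      ((w n).im * (s * Complex.I) + (w n).re : ℂ) ∈ U n := by
    intro s hs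
    have hKc : IsCompact ((fun τ : ℝ => (τ : ℂ) * Complex.I) '' Icc 1 s⁻¹) :=
      isCompact_Icc.image (by fun_prop)
    obtain ⟨R₁, hR₁⟩ := h.eventually_mem_of_compact hKc (by
      rintro _ ⟨τ, hτ, rfl⟩
      have : 0 < τ := lt_of_lt_of_le one_pos hτ.1
      simpa [upperHalf] using this) (image_ball_mem_nhds c hη)
    filter_upwards [hfrC R₁, hwmem] with n hn hwn
    set seg : Set ℂ := (fun t : ℝ => ((w n).im * (t * Complex.I) + (w n).re : ℂ)) '' Icc s 1
      with hseg
    have hsub : seg ⊆ U n := by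
      refine IsPreconnected.subset_of_disjoint_frontier
        (isPreconnected_Icc.image _ (by fun_prop)) (hUo n) ⟨w n, ⟨1, ⟨by linarith [hs.2], le_rfl⟩, ?_⟩, hwn⟩ ?_
      · apply Complex.ext <;> simp
      · rintro _ ⟨t, ht, rfl⟩ hfrp
        have ht0 : 0 < t := hs.1.trans_le ht.1
        have h1 := hn _ hfrp (by simpa using (hwim n).le)
          (by simpa using mul_le_of_le_one_right (hwim n).le ht.2)
        -- Seen from a point of `C` on the vertical segment at height `t Im w`, the point `w n` has
        -- rescaled coordinate `t⁻¹ i`, which stays in a compact set. So `w n` would be good.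
        have h2 := hR₁ _ h1.1 h1.2 (t⁻¹ * Complex.I)
          ⟨t⁻¹, ⟨(one_le_inv₀ ht0).2 ht.2, inv_anti₀ hs.1 ht.1⟩, by push_cast; rfl⟩
        refine hwB n ?_
        convert h2 using 2
        apply Complex.ext
        · simp
        · simp [ht0.ne']
    exact hsub ⟨s, ⟨le_rfl, by linarith [hs.2]⟩, rfl⟩
  obtain ⟨m, hm, g, hg, hga⟩ := h.exists_limit (s := fun n => (w n).im)
    (x := fun n => (w n).re) hwim
  have hgs : ∀ s ∈ Ioo (0 : ℝ) (1 / 2), g (s * Complex.I) = c := by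
    intro s hs
    have hsH : (s * Complex.I : ℂ) ∈ upperHalf := by simpa [upperHalf] using hs.1
    refine tendsto_nhds_unique (hg.tendsto_comp hsH tendsto_id tendsto_const_nhds) ?_
    suffices Tendsto (fun n => F ((w n).im * (s * Complex.I) + (w n).re)) atTop
        (𝓝 (c : OnePoint ℂ)) from this.comp hm.tendsto_atTop
    intro O' hO'
    obtain ⟨δ, hδ, hδO⟩ := exists_image_ball_subset hO'
    -- This exponent factor vanishes at `s = 1/2` and is positive below, so a large `κ` beats any
    -- `δ`.
    have hq : 0 < 1 - (8 / 3 * s - 4 / 3 * s ^ 2) := by nlinarith [hs.1, hs.2]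
    obtain ⟨κ, hκ0, hκ⟩ : ∃ κ : ℝ, 0 ≤ κ ∧
        η * Real.exp (-κ * (1 - (8 / 3 * s - 4 / 3 * s ^ 2))) < δ := by
      have h1 : Tendsto (fun κ : ℝ => η * Real.exp (-(κ * (1 - (8 / 3 * s - 4 / 3 * s ^ 2)))))
          atTop (𝓝 (η * 0)) :=
        (Real.tendsto_exp_neg_atTop_nhds_zero.comp
          (tendsto_id.atTop_mul_const hq)).const_mul η
      rw [mul_zero] at h1
      obtain ⟨κ, hκ1, hκ2⟩ := ((h1.eventually (gt_mem_nhds hδ)).and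
        (eventually_ge_atTop (0 : ℝ))).exists
      exact ⟨κ, hκ2, by simpa only [neg_mul] using hκ1⟩
    obtain ⟨R₁, hR₁⟩ := h.limit _ (image_ball_mem_nhds c (mul_pos hη (Real.exp_pos (-κ))))
    have hev : ∀ᶠ n in atTop, F ((w n).im * (s * Complex.I) + (w n).re) ∈ O' := by
      filter_upwards [hfrC R₁, hcol s hs] with n hn hcoln
      have := h.mem_ball_of_box (hU n) hη hκ0 (hwim n) (hgood n)
        (fun p hp h1 h2 => by
          have := hn p hp h1 (h2.trans (by linarith [hwim n]))
          exact hR₁ p this.1 this.2) hs.2 hcoln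
      exact hδO (mem_image_ball_iff.2 ⟨this.1, this.2.trans_lt hκ⟩)
    exact hev
  have hz₀ : ((1 / 4 : ℝ) * Complex.I : ℂ) ∈ upperHalf := by simp [upperHalf]
  have hgc : ∀ v ∈ upperHalf, g v = c := by
    refine eqOn_const_of_frequently_eq isPreconnected_upperHalf hga hz₀ ?_
    have hinj : Function.Injective fun s : ℝ => (s * Complex.I : ℂ) := fun a b hab => by
      simpa using hab
    have ht : Tendsto (fun s : ℝ => (s * Complex.I : ℂ)) (𝓝[≠] (1 / 4))
        (𝓝[≠] ((1 / 4 : ℝ) * Complex.I)) :=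
      tendsto_nhdsWithin_iff.2 ⟨(Continuous.tendsto (by fun_prop) _).mono_left nhdsWithin_le_nhds,
        eventually_nhdsWithin_of_forall fun s hs hs' => hs (hinj hs')⟩
    refine ht.frequently (Eventually.frequently ?_)
    filter_upwards [nhdsWithin_le_nhds (Ioo_mem_nhds (a := (0 : ℝ)) (b := 1 / 2)
      (by norm_num) (by norm_num))] with s hs using hgs s hs
  -- The rescaled point `i` is `w n` itself, which is bad for every `n`.
  have hlim := hg.tendsto_comp I_mem_upperHalf tendsto_id tendsto_const_nhds
  rw [hgc _ I_mem_upperHalf] at hlim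
  obtain ⟨n, hn⟩ := (hlim.eventually (image_ball_mem_nhds c hη)).exists
  refine hwB (m n) ?_
  rw [← Complex.re_add_im (w (m n)), add_comm]
  exact hn

end HasTangentialLimit

/-! ### Sets bounded by the curve and a ray, in polar coordinates about `-i`. -/

/-- The point of the unit circle at angle `φ` from the real half-line of sign `σ`. -/
noncomputable def arcPt (σ φ : ℝ) : ℂ := ⟨σ * Real.cos φ, Real.sin φ⟩

lemma continuous_arcPt (σ : ℝ) : Continuous (arcPt σ) := by
  have : arcPt σ = fun φ : ℝ => ((σ * Real.cos φ : ℝ) : ℂ) + (Real.sin φ : ℝ) * Complex.I := by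
    funext φ
    apply Complex.ext <;> simp [arcPt, -Complex.ofReal_cos, -Complex.ofReal_sin]
  rw [this]
  fun_prop

lemma norm_arcPt {σ : ℝ} (hσ : σ = 1 ∨ σ = -1) (φ : ℝ) : ‖arcPt σ φ‖ = 1 := by
  have h2 : σ ^ 2 = 1 := by rcases hσ with rfl | rfl <;> norm_num
  have : ‖arcPt σ φ‖ ^ 2 = 1 := by
    rw [Complex.sq_norm, Complex.normSq_apply, arcPt]
    nlinarith [Real.sin_sq_add_cos_sq φ]
  exact (pow_eq_one_iff_of_nonneg (norm_nonneg _) two_ne_zero).1 this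

lemma arcPt_mem_upperHalf (σ : ℝ) {φ : ℝ} (hφ : φ ∈ Ioo 0 Real.pi) : arcPt σ φ ∈ upperHalf :=
  Real.sin_pos_of_mem_Ioo hφ

lemma arcPt_injOn {σ : ℝ} (hσ : σ = 1 ∨ σ = -1) : InjOn (arcPt σ) (Icc 0 Real.pi) := by
  intro a ha b hb hab
  refine Real.injOn_cos ha hb ?_
  have := congrArg Complex.re hab
  have h0 : σ ≠ 0 := by rcases hσ with rfl | rfl <;> norm_num
  exact mul_left_cancel₀ h0 this

lemma eq_of_smul_arcPt_eq {σ : ℝ} (hσ : σ = 1 ∨ σ = -1) {τ τ' a b : ℝ} (hτ : 0 < τ) (hτ' : 0 < τ')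
    (ha : a ∈ Icc 0 Real.pi) (hb : b ∈ Icc 0 Real.pi) (h : (τ : ℂ) * arcPt σ a = τ' * arcPt σ b) :
    a = b := by
  have hn := congrArg norm h
  rw [norm_mul, norm_mul, norm_arcPt hσ, norm_arcPt hσ, mul_one, mul_one, Complex.norm_real,
    Complex.norm_real, Real.norm_of_nonneg hτ.le, Real.norm_of_nonneg hτ'.le] at hn
  rw [hn] at h
  exact arcPt_injOn hσ ha hb (mul_left_cancel₀ (by exact_mod_cast hτ'.ne') h)

lemma exists_arcPt {σ : ℝ} (hσ : σ = 1 ∨ σ = -1) {z : ℂ} (hz : z ∈ upperHalf) :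
    ∃ φ ∈ Ioo 0 Real.pi, z = ‖z‖ * arcPt σ φ := by
  have hz : 0 < z.im := hz
  have h2 : σ * σ = 1 := by rcases hσ with rfl | rfl <;> norm_num
  have hn : 0 < ‖z‖ := hz.trans_le ((le_abs_self _).trans (Complex.abs_im_le_norm z))
  have hsq : z.re ^ 2 + z.im ^ 2 = ‖z‖ ^ 2 := by
    rw [Complex.sq_norm, Complex.normSq_apply]; ring
  have hlt : (σ * z.re / ‖z‖) ^ 2 < 1 := by
    rw [div_pow, div_lt_one (by positivity), mul_pow, pow_two σ, h2]
    nlinarith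
  have habs := abs_lt.1 ((sq_lt_one_iff_abs_lt_one _).1 hlt)
  refine ⟨Real.arccos (σ * z.re / ‖z‖), ⟨Real.arccos_pos.2 habs.2, Real.arccos_lt_pi.2 habs.1⟩, ?_⟩
  apply Complex.ext
  · rw [Complex.re_ofReal_mul, arcPt, Real.cos_arccos habs.1.le habs.2.le]
    field_simp
    linear_combination (-z.re) * h2
  · rw [Complex.im_ofReal_mul, arcPt, Real.sin_arccos]
    have : 1 - (σ * z.re / ‖z‖) ^ 2 = (z.im / ‖z‖) ^ 2 := by
      field_simp
      linear_combination (-z.re ^ 2) * h2 - hsq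
    rw [this, Real.sqrt_sq (by positivity)]
    field_simp

/-- An open set in the half-plane whose frontier, far out, lies on the curve and on the ray from
`-i` at angle `a`. -/
structure IsBoundedByRay (U C : Set ℂ) (σ a R₀ : ℝ) : Prop where
  isOpen : IsOpen U
  closure_subset : closure U ⊆ upperHalf
  frontier_subset : ∀ w ∈ frontier U, R₀ ≤ ‖w‖ →
    w ∈ C ∨ ∃ τ : ℝ, 0 < τ ∧ w + Complex.I = τ * arcPt σ a

lemma IsBoundedByRay.arc_subset {U C : Set ℂ} {σ a R₀ : ℝ} (hU : IsBoundedByRay U C σ a R₀)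
    {τ : ℝ} {J : Set ℝ} (hJ : IsPreconnected J)
    {φ : ℝ} (hφ : φ ∈ J) (hφU : (τ * arcPt σ φ - Complex.I : ℂ) ∈ U)
    (hd : ∀ ψ ∈ J, (τ * arcPt σ ψ - Complex.I : ℂ) ∉ frontier U) :
    ∀ ψ ∈ J, (τ * arcPt σ ψ - Complex.I : ℂ) ∈ U := by
  have hc : Continuous fun ψ => (τ * arcPt σ ψ - Complex.I : ℂ) := by
    have := continuous_arcPt σ
    fun_prop
  have := IsPreconnected.subset_of_disjoint_frontier (hJ.image _ hc.continuousOn) hU.isOpen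
    ⟨_, ⟨φ, hφ, rfl⟩, hφU⟩ (by rintro _ ⟨ψ, hψ, rfl⟩; exact hd ψ hψ)
  exact fun ψ hψ => this ⟨ψ, hψ, rfl⟩

lemma norm_smul_arcPt_sub_I {σ : ℝ} (hσ : σ = 1 ∨ σ = -1) {τ : ℝ} (hτ : 0 < τ) (φ : ℝ) :
    τ - 1 ≤ ‖(τ * arcPt σ φ - Complex.I : ℂ)‖ := by
  have := norm_sub_norm_le (τ * arcPt σ φ : ℂ) Complex.I
  rwa [norm_mul, norm_arcPt hσ, Complex.norm_real, Complex.norm_I, mul_one,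
    Real.norm_of_nonneg hτ.le] at this

lemma not_smul_arcPt_mem_frontier {U C : Set ℂ} {σ a R₀ : ℝ} (hU : IsBoundedByRay U C σ a R₀)
    (hσ : σ = 1 ∨ σ = -1) (ha : a ∈ Ioo 0 Real.pi) {τ φ : ℝ} (hτ : 0 < τ) (hR : R₀ + 1 ≤ τ)
    (hφ : φ ∈ Icc 0 Real.pi) (hne : φ ≠ a) (hC : (τ * arcPt σ φ - Complex.I : ℂ) ∉ C) :
    (τ * arcPt σ φ - Complex.I : ℂ) ∉ frontier U := by
  intro hfr
  rcases hU.frontier_subset _ hfr (by linarith [norm_smul_arcPt_sub_I hσ hτ φ]) with h1 | ⟨τ', h1, h2⟩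
  · exact hC h1
  · rw [sub_add_cancel] at h2
    exact hne (eq_of_smul_arcPt_eq hσ hτ h1 hφ ⟨ha.1.le, ha.2.le⟩ h2)

namespace HasTangentialLimit

variable {F : ℂ → OnePoint ℂ} {C : Set ℂ} {σ : ℝ} {c : OnePoint ℂ}

lemma sign_mul_self (h : HasTangentialLimit F C σ c) : σ * σ = 1 := by
  rcases h.sign with rfl | rfl <;> norm_num

/-- Tangency, with the angle measured at `-i`, where the ray starts. The shift lowers the height by
`1`, which `τ > 2 / sin ψ` absorbs. -/
lemma angle_lt (h : HasTangentialLimit F C σ c) {ψ : ℝ} (hψ : ψ ∈ Ioo 0 (Real.pi / 2)) :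
    ∃ R > 0, ∀ τ φ : ℝ, R ≤ τ → φ ∈ Icc 0 Real.pi → (τ * arcPt σ φ - Complex.I : ℂ) ∈ C →
      φ < ψ := by
  have hs : 0 < Real.sin ψ := Real.sin_pos_of_pos_of_lt_pi hψ.1 (by linarith [hψ.2, Real.pi_pos])
  obtain ⟨R, hR⟩ := h.slope (Real.sin ψ / 2) (by positivity)
  refine ⟨max (R + 1) (2 / Real.sin ψ + 1), by positivity, fun τ φ hτ hφ hC => ?_⟩
  have hτ1 : R + 1 ≤ τ := (le_max_left _ _).trans hτ
  have hτ2 : 2 / Real.sin ψ < τ := by linarith [(le_max_right _ _).trans hτ]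
  have hτ0 : 0 < τ := lt_trans (by positivity) hτ2
  rw [div_lt_iff₀ hs] at hτ2
  have h1 := hR _ hC (by linarith [norm_smul_arcPt_sub_I h.sign hτ0 φ])
  have h0 := mem_upperHalf.1 (h.subset hC)
  simp only [Complex.sub_im, Complex.im_ofReal_mul, Complex.I_im, Complex.sub_re,
    Complex.re_ofReal_mul, Complex.I_re, arcPt, sub_zero] at h1 h0
  have e : σ * (τ * (σ * Real.cos φ)) = τ * Real.cos φ := by
    linear_combination τ * Real.cos φ * h.sign_mul_self
  rw [e] at h1
  have hcos : 0 < Real.cos φ := by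
    by_contra! hneg
    have : τ * Real.cos φ ≤ 0 := mul_nonpos_of_nonneg_of_nonpos hτ0.le hneg
    nlinarith
  have hφ2 : φ ≤ Real.pi / 2 := by
    by_contra! hlt
    exact absurd hcos (not_lt.2 (Real.cos_nonpos_of_pi_div_two_le_of_le hlt.le (by linarith [hφ.2])))
  have h3 : Real.sin ψ / 2 * (τ * Real.cos φ) ≤ Real.sin ψ / 2 * (τ * 1) := by
    have := Real.cos_le_one φ
    gcongr
  have h4 : τ * Real.sin φ < τ * Real.sin ψ := by nlinarith
  have h5 : Real.sin φ < Real.sin ψ := lt_of_mul_lt_mul_left h4 hτ0.le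
  exact (Real.strictMonoOn_sin.lt_iff_lt ⟨by linarith [hφ.1, Real.pi_pos], hφ2⟩
    ⟨by linarith [hψ.1, Real.pi_pos], hψ.2.le⟩).1 h5

/-- Far out, a set bounded by the curve and the ray lies on the side of the curve. -/
lemma angle_lt_of_mem (h : HasTangentialLimit F C σ c) {a : ℝ} (ha : a ∈ Ioo 0 Real.pi) (R₀ : ℝ) :
    ∃ R > 0, ∀ U, IsBoundedByRay U C σ a R₀ → ∀ τ φ : ℝ, R ≤ τ → φ ∈ Ioo 0 Real.pi →
      (τ * arcPt σ φ - Complex.I : ℂ) ∈ U → φ < a := by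
  obtain ⟨R, hR0, hR⟩ := h.angle_lt (ψ := a / 2) ⟨by linarith [ha.1], by linarith [ha.2]⟩
  refine ⟨max R (R₀ + 1), lt_max_of_lt_left hR0, fun U hU τ φ hτ hφ hφU => ?_⟩
  have hτ1 : R ≤ τ := (le_max_left _ _).trans hτ
  have hτ2 : R₀ + 1 ≤ τ := (le_max_right _ _).trans hτ
  have hτ0 : 0 < τ := hR0.trans_le hτ1
  by_contra! hle
  have hc : Continuous fun ψ => (τ * arcPt σ ψ - Complex.I : ℂ) := by
    have := continuous_arcPt σ
    fun_prop
  -- Openness moves the point strictly past the ray, which covers `φ = a`. From there the arc up to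
  -- angle `π` meets neither the ray nor `C`, so it stays in `U` down to imaginary part `-1`.
  have hev : ∀ᶠ φ' in 𝓝[>] φ, (τ * arcPt σ φ' - Complex.I : ℂ) ∈ U ∧ φ' < Real.pi :=
    nhdsWithin_le_nhds (inter_mem (hc.continuousAt (hU.isOpen.mem_nhds hφU)) (Iio_mem_nhds hφ.2))
  obtain ⟨φ', ⟨h1, h2⟩, h3⟩ := (hev.and self_mem_nhdsWithin).exists
  have h3 : φ < φ' := h3
  have hsub := hU.arc_subset isPreconnected_Icc (J := Icc φ' Real.pi) ⟨le_rfl, h2.le⟩ h1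
    (fun ψ hψ => by
      have hψ' : ψ ∈ Icc 0 Real.pi := ⟨by linarith [hφ.1, hψ.1], hψ.2⟩
      refine not_smul_arcPt_mem_frontier hU h.sign ha hτ0 hτ2 hψ'
        (by linarith [hψ.1] : a < ψ).ne' fun hC => ?_
      linarith [hR τ ψ hτ1 hψ' hC, hψ.1, ha.1])
  have h4 := mem_upperHalf.1
    (hU.closure_subset (subset_closure (hsub Real.pi ⟨h2.le, le_rfl⟩)))
  norm_num [arcPt] at h4

/-- Convergence in the sets bounded by the curve and a ray, for a finite limit. -/
lemma eventually_mem_of_boundedByRay_coe {c : ℂ} (h : HasTangentialLimit F C σ c) {a : ℝ}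
    (ha : a ∈ Ioo 0 Real.pi) (R₀ : ℝ) {O : Set (OnePoint ℂ)} (hO : O ∈ 𝓝 (c : OnePoint ℂ)) :
    ∃ R : ℝ, ∀ U, IsBoundedByRay U C σ a R₀ → ∀ z ∈ U, R ≤ ‖z‖ → F z ∈ O := by
  have hsa : 0 < Real.sin a := Real.sin_pos_of_mem_Ioo ha
  -- The bound `sin a / 2` keeps the ray, far out, above slope `k`, so that at slope at most `k` the
  -- frontier lies on `C`; `1/4` is what `eventually_mem_of_low` requires.
  set k : ℝ := min (1 / 4) (Real.sin a / 2) with hk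
  have hk0 : 0 < k := lt_min (by norm_num) (by positivity)
  have hk4 : k ≤ 1 / 4 := min_le_left _ _
  set R₁ : ℝ := max R₀ (2 / Real.sin a + 2) with hR₁
  have hlowC : ∀ U, IsBoundedByRay U C σ a R₀ → ∀ w ∈ frontier U, R₁ ≤ ‖w‖ →
      w.im ≤ k * (σ * w.re) → w ∈ C := by
    intro U hU w hw hwR hslope
    rcases hU.frontier_subset w hw ((le_max_left _ _).trans hwR) with h1 | ⟨τ, hτ, hwτ⟩
    · exact h1
    · exfalso
      have e1 : w = τ * arcPt σ a - Complex.I := by rw [← hwτ]; ring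
      have h2 : ‖w‖ ≤ τ + 1 := by
        rw [e1]
        refine (norm_sub_le _ _).trans_eq ?_
        rw [norm_mul, norm_arcPt h.sign, Complex.norm_real, Complex.norm_I, mul_one,
          Real.norm_of_nonneg hτ.le]
      have h3 : 2 / Real.sin a < τ := by linarith [(le_max_right _ _).trans hwR]
      rw [div_lt_iff₀ hsa] at h3
      rw [e1] at hslope
      simp only [Complex.sub_im, Complex.im_ofReal_mul, Complex.I_im, Complex.sub_re,
        Complex.re_ofReal_mul, Complex.I_re, arcPt, sub_zero] at hslope
      have e : σ * (τ * (σ * Real.cos a)) = τ * Real.cos a := by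
        linear_combination τ * Real.cos a * h.sign_mul_self
      rw [e] at hslope
      have h4 : k * (τ * Real.cos a) ≤ Real.sin a / 2 * (τ * 1) := by
        have h5 : k * (τ * Real.cos a) ≤ k * (τ * 1) := by
          have := Real.cos_le_one a
          gcongr
        have h6 : k * (τ * 1) ≤ Real.sin a / 2 * (τ * 1) := by
          gcongr
          exact min_le_right _ _
        linarith
      nlinarith
  have hlow : ∀ O ∈ 𝓝 (c : OnePoint ℂ), ∃ R : ℝ, ∀ U, IsBoundedByRay U C σ a R₀ →
      ∀ z ∈ U, R ≤ ‖z‖ → z.im ≤ k / 4 * (σ * z.re) → F z ∈ O := fun O hO => by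
    obtain ⟨R, hR⟩ := h.eventually_mem_of_low hk0 hk4 R₁ hO
    exact ⟨R, fun U hU => hR U hU.isOpen hU.closure_subset (hlowC U hU)⟩
  obtain ⟨ψ₁, hψ₁, hψ₁a, hψ₁2, htan⟩ : ∃ ψ₁ > 0, ψ₁ < a ∧ ψ₁ < Real.pi / 2 ∧
      ∀ φ ∈ Ioo 0 ψ₁, Real.sin φ ≤ k / 4 * Real.cos φ := by
    refine ⟨min (a / 2) (Real.arctan (k / 4)), lt_min (by linarith [ha.1])
      (Real.arctan_pos.2 (by positivity)), (min_le_left _ _).trans_lt (by linarith [ha.1]),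
      (min_le_right _ _).trans_lt (Real.arctan_lt_pi_div_two _), fun φ hφ => ?_⟩
    have h1 : φ < Real.arctan (k / 4) := hφ.2.trans_le (min_le_right _ _)
    have h2 : φ < Real.pi / 2 := h1.trans (Real.arctan_lt_pi_div_two _)
    have hcos : 0 < Real.cos φ := Real.cos_pos_of_mem_Ioo ⟨by linarith [hφ.1, Real.pi_pos], h2⟩
    have h3 := Real.strictMonoOn_tan ⟨by linarith [hφ.1, Real.pi_pos], h2⟩
      ⟨Real.neg_pi_div_two_lt_arctan _, Real.arctan_lt_pi_div_two _⟩ h1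
    rw [Real.tan_arctan, Real.tan_eq_sin_div_cos, div_lt_iff₀ hcos] at h3
    exact h3.le
  have hlowφ : ∀ φ ∈ Ioo 0 ψ₁, ∀ τ : ℝ, 0 < τ →
      (τ * arcPt σ φ - Complex.I : ℂ).im ≤ k / 4 * (σ * (τ * arcPt σ φ - Complex.I : ℂ).re) := by
    intro φ hφ τ hτ
    simp only [Complex.sub_im, Complex.im_ofReal_mul, Complex.I_im, Complex.sub_re,
      Complex.re_ofReal_mul, Complex.I_re, arcPt, sub_zero]
    have e : σ * (τ * (σ * Real.cos φ)) = τ * Real.cos φ := by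
      linear_combination τ * Real.cos φ * h.sign_mul_self
    rw [e]
    nlinarith [mul_le_mul_of_nonneg_left (htan φ hφ) hτ.le]
  by_contra! hcon
  choose U hU z hzU hzn hzO using fun n : ℕ => hcon n
  have hzH : ∀ n, z n + Complex.I ∈ upperHalf := fun n => by
    have : 0 < (z n).im := (hU n).closure_subset (subset_closure (hzU n))
    change 0 < (z n + Complex.I).im
    rw [Complex.add_im, Complex.I_im]; linarith
  choose φ hφ hzφ using fun n => exists_arcPt h.sign (hzH n)
  set τ : ℕ → ℝ := fun n => ‖z n + Complex.I‖ with hτ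
  have hτ0 : ∀ n, 0 < τ n := fun n => norm_pos_iff.2 fun h0 => by
    have := hzH n
    rw [h0] at this
    simp [upperHalf] at this
  have hzeq : ∀ n, z n = τ n * arcPt σ (φ n) - Complex.I := fun n => by
    rw [← hzφ n]; ring
  have hτtop : Tendsto τ atTop atTop := by
    refine tendsto_atTop_mono (fun n => ?_)
      (tendsto_atTop_add_const_right atTop (-1 : ℝ) tendsto_natCast_atTop_atTop)
    have := norm_sub_norm_le (z n) (-Complex.I)
    rw [norm_neg, Complex.norm_I, sub_neg_eq_add] at this
    linarith [hzn n]
  have hφlow : ∀ᶠ n in atTop, ψ₁ ≤ φ n := by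
    obtain ⟨R, hR⟩ := hlow O hO
    filter_upwards [tendsto_natCast_atTop_atTop.eventually (eventually_ge_atTop R)] with n hn
    by_contra! hlt
    refine hzO n (hR (U n) (hU n) (z n) (hzU n) (hn.trans (hzn n)) ?_)
    rw [hzeq n]
    exact hlowφ _ ⟨(hφ n).1, hlt⟩ _ (hτ0 n)
  have hφa : ∀ᶠ n in atTop, φ n < a := by
    obtain ⟨R, -, hR⟩ := h.angle_lt_of_mem ha R₀
    filter_upwards [hτtop.eventually (eventually_ge_atTop R)] with n hn
    exact hR (U n) (hU n) (τ n) (φ n) hn (hφ n) (by rw [← hzeq n]; exact hzU n)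
  -- The arc from `z n` down to angle `ψ` stays in `U n`: far out `C` has angle below `ψ`, and the
  -- ray has angle `a > φ n`.
  have hsector : ∀ ψ ∈ Ioo 0 ψ₁, ∀ᶠ n in atTop,
      (τ n * arcPt σ ψ - Complex.I : ℂ) ∈ U n := by
    intro ψ hψ
    obtain ⟨R, -, hR⟩ := h.angle_lt (ψ := ψ) ⟨hψ.1, hψ.2.trans hψ₁2⟩
    filter_upwards [hφlow, hφa, hτtop.eventually (eventually_ge_atTop (max R (R₀ + 1)))]
      with n h1 h2 h3
    refine (hU n).arc_subset isPreconnected_Icc (J := Icc ψ (φ n)) (φ := φ n)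
      ⟨hψ.2.le.trans h1, le_rfl⟩ (by rw [← hzeq n]; exact hzU n) (fun χ hχ => ?_) ψ
      ⟨le_rfl, hψ.2.le.trans h1⟩
    have hχ' : χ ∈ Icc 0 Real.pi := ⟨hψ.1.le.trans hχ.1, hχ.2.trans (hφ n).2.le⟩
    refine not_smul_arcPt_mem_frontier (hU n) h.sign ha (hτ0 n) ((le_max_right _ _).trans h3) hχ'
      (hχ.2.trans_lt h2).ne fun hC => ?_
    exact absurd (hR _ _ ((le_max_left _ _).trans h3) hχ' hC) (not_lt.2 hχ.1)
  have hsectorlim : ∀ ψ ∈ Ioo 0 ψ₁,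
      Tendsto (fun n => F (τ n * arcPt σ ψ - Complex.I)) atTop (𝓝 (c : OnePoint ℂ)) := by
    intro ψ hψ O' hO'
    obtain ⟨R, hR⟩ := hlow O' hO'
    have hev : ∀ᶠ n in atTop, F (τ n * arcPt σ ψ - Complex.I) ∈ O' := by
      filter_upwards [hsector ψ hψ, hτtop.eventually (eventually_ge_atTop (R + 1))] with n h1 h2
      exact hR _ (hU n) _ h1 (by linarith [norm_smul_arcPt_sub_I h.sign (hτ0 n) ψ])
        (hlowφ ψ hψ _ (hτ0 n))
    exact hev
  -- Admissible translations are real, so the scaling is about `0` instead of `-i`. The error `i / τ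
  -- n` tends to `0` and is absorbed by continuous convergence.
  obtain ⟨m, hm, g, hg, hga⟩ := h.exists_limit (s := τ) (x := fun _ => 0) hτ0
  have hshift : Tendsto (fun n => Complex.I / (τ n : ℂ)) atTop (𝓝 0) := by
    rw [tendsto_zero_iff_norm_tendsto_zero]
    refine (tendsto_inv_atTop_zero.comp hτtop).congr fun n => ?_
    rw [norm_div, Complex.norm_I, Complex.norm_real, Real.norm_of_nonneg (hτ0 n).le, one_div]
    rfl
  have hscale : ∀ n v, F (τ n * (v - Complex.I / τ n) + (0 : ℝ)) = F (τ n * v - Complex.I) := by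
    intro n v
    have : (τ n : ℂ) ≠ 0 := by exact_mod_cast (hτ0 n).ne'
    congr 1
    rw [mul_sub, mul_div_cancel₀ _ this]
    simp
  have hgψ : ∀ ψ ∈ Ioo 0 ψ₁, g (arcPt σ ψ) = c := by
    intro ψ hψ
    have hψH : arcPt σ ψ ∈ upperHalf :=
      arcPt_mem_upperHalf σ ⟨hψ.1, by linarith [hψ.2, Real.pi_pos]⟩
    have hv : Tendsto (fun n => arcPt σ ψ - Complex.I / (τ (m n) : ℂ)) atTop
        (𝓝 (arcPt σ ψ)) := by
      simpa using (hshift.comp hm.tendsto_atTop).const_sub (arcPt σ ψ)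
    have h1 := hg.tendsto_comp hψH tendsto_id hv
    simp only [id, hscale] at h1
    exact tendsto_nhds_unique h1 ((hsectorlim ψ hψ).comp hm.tendsto_atTop)
  have hgc : ∀ v ∈ upperHalf, g v = c := by
    have hmid : ψ₁ / 2 ∈ Ioo 0 ψ₁ := ⟨by linarith, by linarith⟩
    have hψπ : ∀ ψ ∈ Ioo 0 ψ₁, ψ ∈ Ioo 0 Real.pi := fun ψ hψ =>
      ⟨hψ.1, by linarith [hψ.2, Real.pi_pos]⟩
    refine eqOn_const_of_frequently_eq isPreconnected_upperHalf hga
      (arcPt_mem_upperHalf σ (hψπ _ hmid)) ?_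
    have hIoo : ∀ᶠ ψ in 𝓝[≠] (ψ₁ / 2), ψ ∈ Ioo 0 ψ₁ :=
      nhdsWithin_le_nhds (Ioo_mem_nhds hmid.1 hmid.2)
    have ht : Tendsto (arcPt σ) (𝓝[≠] (ψ₁ / 2)) (𝓝[≠] (arcPt σ (ψ₁ / 2))) := by
      refine tendsto_nhdsWithin_iff.2
        ⟨(continuous_arcPt σ).continuousAt.mono_left nhdsWithin_le_nhds, ?_⟩
      filter_upwards [hIoo, self_mem_nhdsWithin] with ψ hψ hne heq
      exact hne (arcPt_injOn h.sign (Ioo_subset_Icc_self (hψπ _ hψ))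
        (Ioo_subset_Icc_self (hψπ _ hmid)) heq)
    exact ht.frequently (hIoo.mono fun ψ hψ => hgψ ψ hψ).frequently
  have hev : ∀ᶠ n in atTop, φ (m n) ∈ Icc ψ₁ a := by
    filter_upwards [hm.tendsto_atTop.eventually hφlow, hm.tendsto_atTop.eventually hφa]
      with n h1 h2 using ⟨h1, h2.le⟩
  obtain ⟨φ₀, hφ₀, j, hj, hlim⟩ := isCompact_Icc.tendsto_subseq' hev.frequently
  have hφ₀H : arcPt σ φ₀ ∈ upperHalf :=
    arcPt_mem_upperHalf σ ⟨hψ₁.trans_le hφ₀.1, hφ₀.2.trans_lt ha.2⟩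
  have hv : Tendsto (fun n => arcPt σ (φ (m (j n))) - Complex.I / (τ (m (j n)) : ℂ)) atTop
      (𝓝 (arcPt σ φ₀)) := by
    have h1 := ((continuous_arcPt σ).tendsto φ₀).comp hlim
    have h2 := hshift.comp (hm.tendsto_atTop.comp hj.tendsto_atTop)
    simpa using h1.sub h2
  have h1 := hg.tendsto_comp hφ₀H hj.tendsto_atTop hv
  simp only [hscale] at h1
  rw [hgc _ hφ₀H] at h1
  obtain ⟨n, hn⟩ := (h1.eventually hO).exists
  rw [← hzeq] at hn
  exact hzO _ hn

/-- Convergence in the sets bounded by the curve and a ray. -/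
lemma eventually_mem_of_boundedByRay (h : HasTangentialLimit F C σ c) {a : ℝ}
    (ha : a ∈ Ioo 0 Real.pi) (R₀ : ℝ) {O : Set (OnePoint ℂ)} (hO : O ∈ 𝓝 c) :
    ∃ R : ℝ, ∀ U, IsBoundedByRay U C σ a R₀ → ∀ z ∈ U, R ≤ ‖z‖ → F z ∈ O := by
  induction c using OnePoint.rec with
  | coe c => exact h.eventually_mem_of_boundedByRay_coe ha R₀ hO
  | infty =>
    have h' := h.sphInv_comp
    rw [sphInv_infty] at h'
    have hO' : sphInv ⁻¹' O ∈ 𝓝 ((0 : ℂ) : OnePoint ℂ) :=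
      continuous_sphInv.continuousAt (by rwa [sphInv_zero])
    obtain ⟨R, hR⟩ := h'.eventually_mem_of_boundedByRay_coe ha R₀ hO'
    exact ⟨R, fun U hU z hz hzR => by simpa using hR U hU z hz hzR⟩

/-- Some point of the curve lies in no set bounded by the curve and the ray. -/
lemma exists_not_mem_of_boundedByRay (h : HasTangentialLimit F C σ c) (hCc : IsClosed C) {a : ℝ}
    (ha : a ∈ Ioo 0 Real.pi) (R₀ : ℝ) :
    ∃ p ∈ C, ∀ U, IsBoundedByRay U C σ a R₀ → p ∉ U := by
  obtain ⟨R, hR0, hR⟩ := h.angle_lt (ψ := a / 2) ⟨by linarith [ha.1], by linarith [ha.2]⟩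
  obtain ⟨q, hq, -⟩ := h.unbounded 0
  -- The last term makes the circle of radius `τ` enclose a point of `C`, so that `C` crosses it.
  set τ : ℝ := max (max R (R₀ + 1)) ‖q - -Complex.I‖ with hτ
  have hτ1 : R ≤ τ := (le_max_left _ _).trans (le_max_left _ _)
  have hτ2 : R₀ + 1 ≤ τ := (le_max_right _ _).trans (le_max_left _ _)
  have hτ0 : 0 < τ := hR0.trans_le hτ1
  obtain ⟨w, hw, hwτ⟩ := h.exists_mem_norm_sub_eq hq (le_max_right _ _ : _ ≤ τ)
  have hcomp : IsCompact (C ∩ Metric.sphere (-Complex.I) τ) :=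
    (isCompact_sphere _ _).inter_left hCc
  obtain ⟨p, ⟨hpC, hpτ⟩, hmin⟩ := hcomp.exists_isMinOn ⟨w, hw, mem_sphere_iff_norm.2 hwτ⟩
    Complex.continuous_im.continuousOn
  refine ⟨p, hpC, fun U hU hpU => ?_⟩
  have hpH : p + Complex.I ∈ upperHalf := by
    have : 0 < p.im := h.subset hpC
    change 0 < (p + Complex.I).im
    rw [Complex.add_im, Complex.I_im]; linarith
  obtain ⟨φ, hφ, hpφ⟩ := exists_arcPt h.sign hpH
  rw [mem_sphere_iff_norm, sub_neg_eq_add] at hpτ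
  rw [hpτ] at hpφ
  have hpeq : p = τ * arcPt σ φ - Complex.I := by rw [← hpφ]; ring
  have hφI : φ ∈ Icc 0 Real.pi := Ioo_subset_Icc_self hφ
  have hφa := hR τ φ hτ1 hφI (hpeq ▸ hpC)
  -- A frontier point on the arc below `p` would be on `C`, hence by minimality equal to `p`, which
  -- is interior to `U`. So the arc stays in `U` down to angle `0`, where the imaginary part is
  -- `-1`.
  have hsub := hU.arc_subset isPreconnected_Icc (J := Icc 0 φ) ⟨hφ.1.le, le_rfl⟩ (hpeq ▸ hpU)
    (fun ψ hψ hfr => by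
      have hψI : ψ ∈ Icc 0 Real.pi := ⟨hψ.1, hψ.2.trans hφI.2⟩
      refine not_smul_arcPt_mem_frontier hU h.sign ha hτ0 hτ2 hψI
        (by linarith [hψ.2, ha.1] : ψ < a).ne (fun hC => ?_) hfr
      have hle : p.im ≤ (τ * arcPt σ ψ - Complex.I : ℂ).im := hmin ⟨hC, by
        rw [mem_sphere_iff_norm, sub_neg_eq_add, sub_add_cancel, norm_mul, norm_arcPt h.sign,
          Complex.norm_real, mul_one, Real.norm_of_nonneg hτ0.le]⟩
      rw [hpeq] at hle
      simp only [Complex.sub_im, Complex.im_ofReal_mul, Complex.I_im, arcPt] at hle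
      have hs : Real.sin φ ≤ Real.sin ψ := le_of_mul_le_mul_left (by linarith) hτ0
      have hle' : φ ≤ ψ := (Real.strictMonoOn_sin.le_iff_le
        ⟨by linarith [hφ.1, Real.pi_pos], by linarith [ha.2]⟩
        ⟨by linarith [hψ.1, Real.pi_pos], by linarith [ha.2, hψ.2]⟩).1 hs
      have heq : ψ = φ := le_antisymm hψ.2 hle'
      rw [heq, ← hpeq, hU.isOpen.frontier_eq] at hfr
      exact hfr.2 hpU)
  have h4 := mem_upperHalf.1 (hU.closure_subset (subset_closure (hsub 0 ⟨le_rfl, hφ.1.le⟩)))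
  norm_num [arcPt] at h4

end HasTangentialLimit

/-! ### Transfer between the disc and the half-plane -/

/-- The Cayley transform from the upper half-plane to the disc which sends `∞` to `ζ`. -/
noncomputable def fromHalf (ζ w : ℂ) : ℂ := ζ * (w - Complex.I) / (w + Complex.I)

/-- The Cayley transform from the disc to the upper half-plane which sends `ζ` to `∞`. -/
noncomputable def toHalf (ζ z : ℂ) : ℂ := Complex.I * (ζ + z) / (ζ - z)

section Cayley

variable {ζ w z : ℂ}

lemma add_I_ne_zero (hw : 0 ≤ w.im) : w + Complex.I ≠ 0 := by
  intro h
  have := congrArg Complex.im h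
  simp at this
  linarith

lemma norm_sub_I_sq (w : ℂ) : ‖w - Complex.I‖ ^ 2 = ‖w + Complex.I‖ ^ 2 - 4 * w.im := by
  rw [Complex.sq_norm, Complex.sq_norm, Complex.normSq_apply, Complex.normSq_apply]
  simp
  ring

lemma one_sub_norm_fromHalf_sq (hζ : ‖ζ‖ = 1) (hw : w + Complex.I ≠ 0) :
    1 - ‖fromHalf ζ w‖ ^ 2 = 4 * w.im / ‖w + Complex.I‖ ^ 2 := by
  have h0 : ‖w + Complex.I‖ ≠ 0 := norm_ne_zero_iff.2 hw
  rw [fromHalf, norm_div, norm_mul, hζ, one_mul, div_pow, norm_sub_I_sq]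
  field_simp
  ring

lemma fromHalf_mem (hζ : ‖ζ‖ = 1) (hw : w ∈ upperHalf) : fromHalf ζ w ∈ unitDisc := by
  have hw' : 0 < w.im := hw
  have h0 := add_I_ne_zero hw'.le
  have h1 := one_sub_norm_fromHalf_sq hζ h0
  have h2 : 0 < 4 * w.im / ‖w + Complex.I‖ ^ 2 := by
    have := norm_pos_iff.2 h0
    positivity
  change ‖fromHalf ζ w‖ < 1
  nlinarith [norm_nonneg (fromHalf ζ w)]

lemma sub_ne_zero_of_mem_unitDisc (hζ : ‖ζ‖ = 1) (hz : z ∈ unitDisc) : ζ - z ≠ 0 := by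
  intro h
  have hz' : ‖z‖ < 1 := hz
  rw [← sub_eq_zero.1 h, hζ] at hz'
  exact lt_irrefl _ hz'

lemma toHalf_add_I (h : ζ - z ≠ 0) : toHalf ζ z + Complex.I = 2 * Complex.I * ζ / (ζ - z) := by
  rw [toHalf]; field_simp; ring

lemma fromHalf_sub (hw : w + Complex.I ≠ 0) :
    fromHalf ζ w - ζ = -(2 * Complex.I * ζ) / (w + Complex.I) := by
  rw [fromHalf]; field_simp; ring

lemma fromHalf_toHalf (hζ : ‖ζ‖ = 1) (h : ζ - z ≠ 0) : fromHalf ζ (toHalf ζ z) = z := by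
  have hζ0 : ζ ≠ 0 := norm_ne_zero_iff.1 (by rw [hζ]; norm_num)
  have h1 := toHalf_add_I h
  have h2 : toHalf ζ z + Complex.I ≠ 0 := by
    rw [h1]
    exact div_ne_zero (mul_ne_zero (mul_ne_zero two_ne_zero Complex.I_ne_zero) hζ0) h
  have h3 := fromHalf_sub (ζ := ζ) h2
  rw [h1] at h3
  have hI := Complex.I_ne_zero
  have : -(2 * Complex.I * ζ) / (2 * Complex.I * ζ / (ζ - z)) = z - ζ := by
    field_simp
    ring
  rw [this] at h3
  exact sub_left_injective h3

lemma toHalf_fromHalf (hζ : ‖ζ‖ = 1) (hw : w + Complex.I ≠ 0) : toHalf ζ (fromHalf ζ w) = w := by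
  have hζ0 : ζ ≠ 0 := norm_ne_zero_iff.1 (by rw [hζ]; norm_num)
  have hI := Complex.I_ne_zero
  have h1 : ζ - fromHalf ζ w = 2 * Complex.I * ζ / (w + Complex.I) := by
    rw [← neg_sub, fromHalf_sub hw]; ring
  have h2 : ζ - fromHalf ζ w ≠ 0 := by
    rw [h1]
    exact div_ne_zero (mul_ne_zero (mul_ne_zero two_ne_zero hI) hζ0) hw
  have h3 := toHalf_add_I h2
  rw [h1, div_div_cancel₀ (mul_ne_zero (mul_ne_zero two_ne_zero hI) hζ0)] at h3
  exact add_left_injective _ h3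

lemma toHalf_add_I_ne_zero (hζ : ‖ζ‖ = 1) (h : ζ - z ≠ 0) : toHalf ζ z + Complex.I ≠ 0 := by
  have hζ0 : ζ ≠ 0 := norm_ne_zero_iff.1 (by rw [hζ]; norm_num)
  rw [toHalf_add_I h]
  exact div_ne_zero (mul_ne_zero (mul_ne_zero two_ne_zero Complex.I_ne_zero) hζ0) h

lemma norm_toHalf_add_I (hζ : ‖ζ‖ = 1) (h : ζ - z ≠ 0) :
    ‖toHalf ζ z + Complex.I‖ = 2 / ‖z - ζ‖ := by
  rw [toHalf_add_I h, norm_div, norm_mul, norm_mul, hζ, norm_sub_rev]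
  simp

lemma toHalf_mem (hζ : ‖ζ‖ = 1) (hz : z ∈ unitDisc) : toHalf ζ z ∈ upperHalf := by
  have hz' : ‖z‖ < 1 := hz
  have h := sub_ne_zero_of_mem_unitDisc hζ hz
  have h0 := toHalf_add_I_ne_zero hζ h
  have h1 := one_sub_norm_fromHalf_sq hζ h0
  rw [fromHalf_toHalf hζ h, eq_div_iff (by simpa using h0)] at h1
  have h2 : 0 < (1 - ‖z‖ ^ 2) * ‖toHalf ζ z + Complex.I‖ ^ 2 := by
    have := norm_pos_iff.2 h0
    have h3 : 0 < 1 - ‖z‖ ^ 2 := by nlinarith [norm_nonneg z]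
    positivity
  change 0 < (toHalf ζ z).im
  linarith

lemma analyticAt_fromHalf (ζ : ℂ) (hw : w + Complex.I ≠ 0) : AnalyticAt ℂ (fromHalf ζ) w := by
  unfold fromHalf
  fun_prop (disch := assumption)

lemma analyticAt_toHalf (h : ζ - z ≠ 0) : AnalyticAt ℂ (toHalf ζ) z := by
  unfold toHalf
  fun_prop (disch := assumption)

lemma bijOn_toHalf (hζ : ‖ζ‖ = 1) : BijOn (toHalf ζ) unitDisc upperHalf :=
  InvOn.bijOn (f' := fromHalf ζ)
    ⟨fun _ hz => fromHalf_toHalf hζ (sub_ne_zero_of_mem_unitDisc hζ hz),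
      fun _ hw => toHalf_fromHalf hζ (add_I_ne_zero (mem_upperHalf.1 hw).le)⟩
    (fun _ hz => toHalf_mem hζ hz) (fun _ hw => fromHalf_mem hζ hw)

lemma bijOn_fromHalf (hζ : ‖ζ‖ = 1) : BijOn (fromHalf ζ) upperHalf unitDisc :=
  InvOn.bijOn (f' := toHalf ζ)
    ⟨fun _ hw => toHalf_fromHalf hζ (add_I_ne_zero (mem_upperHalf.1 hw).le),
      fun _ hz => fromHalf_toHalf hζ (sub_ne_zero_of_mem_unitDisc hζ hz)⟩
    (fun _ hw => fromHalf_mem hζ hw) (fun _ hz => toHalf_mem hζ hz)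

lemma affine_mem_upperHalf {s x : ℝ} (hs : 0 < s) (hw : w ∈ upperHalf) :
    s * w + x ∈ upperHalf := by
  simpa [upperHalf] using mul_pos hs hw

lemma bijOn_affine {s x : ℝ} (hs : 0 < s) :
    BijOn (fun w : ℂ => s * w + x) upperHalf upperHalf := by
  have h0 : (s : ℂ) ≠ 0 := by exact_mod_cast hs.ne'
  refine ⟨fun w hw => affine_mem_upperHalf hs hw, fun a _ b _ hab => ?_, fun w hw => ?_⟩
  · exact mul_left_cancel₀ h0 (add_right_cancel hab)
  · refine ⟨(s⁻¹ : ℝ) * w + (-(s⁻¹ * x) : ℝ), affine_mem_upperHalf (inv_pos.2 hs) hw, ?_⟩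
    push_cast
    field_simp
    ring

lemma isDiscAutomorphism_conj_affine (hζ : ‖ζ‖ = 1) {s x : ℝ} (hs : 0 < s) :
    IsDiscAutomorphism fun z => fromHalf ζ (s * toHalf ζ z + x) := by
  constructor
  · intro z hz
    have h1 := (analyticAt_toHalf (sub_ne_zero_of_mem_unitDisc hζ hz)).differentiableAt
    have h2 := (analyticAt_fromHalf ζ (add_I_ne_zero (mem_upperHalf.1
      (affine_mem_upperHalf (x := x) hs (toHalf_mem hζ hz))).le)).differentiableAt
    exact (h2.comp z (f := fun z => s * toHalf ζ z + x)
      ((h1.const_mul _).add_const _)).differentiableWithinAt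
  · exact (bijOn_fromHalf hζ).comp ((bijOn_affine hs).comp (bijOn_toHalf hζ))

/-- In the half-plane the pseudo-hyperbolic distance is `|p - q| / |p - q̄|`. -/
lemma norm_sub_I_le_of_pseudoHypDist_le (hζ : ‖ζ‖ = 1) {p q : ℂ} (hp : p ∈ upperHalf)
    (hq : q ∈ upperHalf) {r : ℝ} (h : pseudoHypDist (fromHalf ζ p) (fromHalf ζ q) ≤ r) :
    ‖p - q‖ ≤ r * ‖p - (starRingEnd ℂ) q‖ := by
  have hp0 := add_I_ne_zero (mem_upperHalf.1 hp).le
  have hq0 := add_I_ne_zero (mem_upperHalf.1 hq).le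
  have hq0' : (starRingEnd ℂ) q - Complex.I ≠ 0 := by
    have := (map_ne_zero (starRingEnd ℂ)).2 hq0
    simpa [sub_eq_add_neg] using this
  have hζ0 : ζ * (starRingEnd ℂ) ζ = 1 := by rw [Complex.mul_conj', hζ]; norm_num
  have e1 : fromHalf ζ p - fromHalf ζ q =
      ζ * (2 * Complex.I) * (p - q) / ((p + Complex.I) * (q + Complex.I)) := by
    rw [fromHalf, fromHalf]; field_simp; ring
  have e2 : 1 - fromHalf ζ p * (starRingEnd ℂ) (fromHalf ζ q) =
      -(2 * Complex.I) * (p - (starRingEnd ℂ) q) /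
        ((p + Complex.I) * ((starRingEnd ℂ) q - Complex.I)) := by
    have : (starRingEnd ℂ) (fromHalf ζ q) = (starRingEnd ℂ) ζ *
        ((starRingEnd ℂ) q + Complex.I) / ((starRingEnd ℂ) q - Complex.I) := by
      simp [fromHalf, sub_eq_add_neg]
    rw [this, fromHalf, div_mul_div_comm, eq_div_iff (mul_ne_zero hp0 hq0'), sub_mul,
      div_mul_cancel₀ _ (mul_ne_zero hp0 hq0')]
    linear_combination (-(p - Complex.I) * ((starRingEnd ℂ) q + Complex.I)) * hζ0
  have hn : ‖(starRingEnd ℂ) q - Complex.I‖ = ‖q + Complex.I‖ := by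
    rw [← RCLike.norm_conj (q + Complex.I)]; simp [sub_eq_add_neg]
  have hpq : p - (starRingEnd ℂ) q ≠ 0 := by
    intro h0
    have := congrArg Complex.im h0
    simp at this
    linarith [mem_upperHalf.1 hp, mem_upperHalf.1 hq]
  have h1 := norm_ne_zero_iff.2 hp0
  have h2 := norm_ne_zero_iff.2 hq0
  have h3 := norm_pos_iff.2 hpq
  rw [pseudoHypDist, e1, e2] at h
  simp only [norm_div, norm_mul, norm_neg, hn, hζ, Complex.norm_I, mul_one, one_mul] at h
  have e3 : ‖(2 : ℂ)‖ * ‖p - q‖ / (‖p + Complex.I‖ * ‖q + Complex.I‖) /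
      (‖(2 : ℂ)‖ * ‖p - (starRingEnd ℂ) q‖ / (‖p + Complex.I‖ * ‖q + Complex.I‖)) =
      ‖p - q‖ / ‖p - (starRingEnd ℂ) q‖ := by
    rw [Complex.norm_two]
    field_simp
  rwa [e3, div_le_iff₀ h3] at h

end Cayley

/-! ### The hypotheses and the regions, transported to the half-plane. -/

/-- The closed disc of pseudo-hyperbolic radius `r` about `i` in the half-plane. -/
def hypDiscI (r : ℝ) : Set ℂ := {v | ‖v - Complex.I‖ ≤ r * ‖v + Complex.I‖}

lemma norm_le_of_mem_hypDiscI {r : ℝ} (hr : r < 1) {v : ℂ} (hv : v ∈ hypDiscI r) :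
    ‖v‖ ≤ (1 + |r|) / (1 - r) := by
  rw [le_div_iff₀ (by linarith)]
  have h1 : ‖v - Complex.I‖ ≤ r * ‖v + Complex.I‖ := hv
  have h2 := norm_sub_norm_le v Complex.I
  have h3 := norm_add_le v Complex.I
  have h4 := norm_sub_norm_le v (-Complex.I)
  rw [norm_neg, sub_neg_eq_add] at h4
  rw [Complex.norm_I] at h2 h3 h4
  have h5 : r * ‖v + Complex.I‖ ≤ r * ‖v‖ + |r| := by
    have : r * (‖v + Complex.I‖ - ‖v‖) ≤ |r| * 1 := by
      refine (le_abs_self _).trans ?_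
      rw [abs_mul]
      exact mul_le_mul_of_nonneg_left (abs_le.2 ⟨by linarith, by linarith⟩) (abs_nonneg r)
    linarith
  linarith

lemma isCompact_hypDiscI {r : ℝ} (hr : r < 1) : IsCompact (hypDiscI r) := by
  refine Metric.isCompact_of_isClosed_isBounded (isClosed_le (by fun_prop) (by fun_prop)) ?_
  refine (Metric.isBounded_closedBall (x := (0 : ℂ)) (r := (1 + |r|) / (1 - r))).subset
    fun v hv => ?_
  rw [mem_closedBall_zero_iff]
  exact norm_le_of_mem_hypDiscI hr hv

lemma hypDiscI_subset {r : ℝ} (hr0 : 0 ≤ r) (hr : r < 1) : hypDiscI r ⊆ upperHalf := by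
  intro v hv
  have h1 : ‖v - Complex.I‖ ≤ r * ‖v + Complex.I‖ := hv
  have h2 := norm_sub_I_sq v
  have h3 : 0 < ‖v + Complex.I‖ := by
    rw [norm_pos_iff]
    intro h0
    rw [h0, norm_zero, mul_zero] at h1
    have h4 := eq_of_sub_eq_zero (norm_le_zero_iff.1 h1)
    rw [h4] at h0
    have := congrArg Complex.im h0
    norm_num at this
  have h4 : ‖v - Complex.I‖ ^ 2 ≤ r ^ 2 * ‖v + Complex.I‖ ^ 2 := by
    rw [← mul_pow]
    exact pow_le_pow_left₀ (norm_nonneg _) h1 2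
  have h5 : 0 < (1 - r ^ 2) * ‖v + Complex.I‖ ^ 2 := by
    have : 0 < 1 - r ^ 2 := by nlinarith
    positivity
  change 0 < v.im
  linarith

lemma norm_circlePt (θ : ℝ) : ‖circlePt θ‖ = 1 := Complex.norm_exp_ofReal_mul_I θ

lemma isAffineNormal_comp_fromHalf {f : ℂ → OnePoint ℂ}
    (hf : ∀ z ∈ unitDisc, SphericallyAnalyticAt f z) (hN : IsNormalOnDisc f) {ζ : ℂ}
    (hζ : ‖ζ‖ = 1) : IsAffineNormal fun w => f (fromHalf ζ w) := by
  intro s x hs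
  have hφ := fun n => isDiscAutomorphism_conj_affine hζ (x := x n) (hs n)
  obtain ⟨k, hk, g, hg⟩ := hN _ hφ
  refine ⟨k, hk, fun w => g (fromHalf ζ w), fun w hw => ?_⟩
  have hc := hg.continuouslyConvergesOn fun n z hz => by
    have h1 := ((hφ (k n)).1.differentiableAt (isOpen_unitDisc.mem_nhds hz)).continuousAt
    exact ContinuousAt.comp (g := f) (hf _ ((hφ (k n)).2.mapsTo hz)).continuousAt h1
  have h0 := add_I_ne_zero (mem_upperHalf.1 hw).le
  have ht : Tendsto (fun p : ℕ × ℂ => (p.1, fromHalf ζ p.2)) (atTop ×ˢ 𝓝 w)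
      (atTop ×ˢ 𝓝 (fromHalf ζ w)) :=
    tendsto_fst.prodMk ((analyticAt_fromHalf ζ h0).continuousAt.tendsto.comp tendsto_snd)
  refine ((hc _ (fromHalf_mem hζ hw)).comp ht).congr' ?_
  filter_upwards [tendsto_snd.eventually (isOpen_upperHalf.mem_nhds hw)] with p hp
  have hp' : p.2 ∈ upperHalf := hp
  simp only [Function.comp]
  rw [toHalf_fromHalf hζ (add_I_ne_zero (mem_upperHalf.1 hp').le)]

section Curve

variable {γ : ℝ → ℂ} {ζ : ℂ}

lemma IsSimpleCurveEndingAt.eventually_mem_Ico (_ : IsSimpleCurveEndingAt γ ζ) :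
    ∀ᶠ t in 𝓝[<] (1 : ℝ), t ∈ Ico (0 : ℝ) 1 :=
  Filter.mem_of_superset (Ioo_mem_nhdsLT zero_lt_one) Ioo_subset_Ico_self

lemma IsSimpleCurveEndingAt.continuousOn_toHalf (hγ : IsSimpleCurveEndingAt γ ζ) (hζ : ‖ζ‖ = 1) :
    ContinuousOn (fun t => toHalf ζ (γ t)) (Ico 0 1) := fun t ht =>
  (analyticAt_toHalf (sub_ne_zero_of_mem_unitDisc hζ (hγ.mapsTo ht))).continuousAt.comp_continuousWithinAt
    (hγ.continuousOn t ht)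

lemma IsSimpleCurveEndingAt.tendsto_norm_toHalf (hγ : IsSimpleCurveEndingAt γ ζ) (hζ : ‖ζ‖ = 1) :
    Tendsto (fun t => ‖toHalf ζ (γ t)‖) (𝓝[<] 1) atTop := by
  have h1 : Tendsto (fun t => ‖γ t - ζ‖) (𝓝[<] 1) (𝓝[>] 0) := by
    refine tendsto_nhdsWithin_iff.2 ⟨?_, ?_⟩
    · simpa using (hγ.tendsto.sub_const ζ).norm
    · filter_upwards [hγ.eventually_mem_Ico] with t ht
      have := sub_ne_zero_of_mem_unitDisc hζ (hγ.mapsTo ht)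
      rw [norm_sub_rev]
      exact norm_pos_iff.2 this
  have h2 : Tendsto (fun t => 2 * ‖γ t - ζ‖⁻¹ + -1) (𝓝[<] 1) atTop :=
    tendsto_atTop_add_const_right _ _
      ((tendsto_inv_nhdsGT_zero.comp h1).const_mul_atTop two_pos)
  refine tendsto_atTop_mono' _ ?_ h2
  filter_upwards [hγ.eventually_mem_Ico] with t ht
  have h3 := norm_toHalf_add_I hζ (sub_ne_zero_of_mem_unitDisc hζ (hγ.mapsTo ht))
  have h4 := norm_add_le (toHalf ζ (γ t)) Complex.I
  rw [h3, Complex.norm_I, div_eq_mul_inv] at h4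
  linarith

/-- The image of `[0, l]` is bounded, so a large modulus forces `t` near `1`. This turns limits in
the parameter into limits along the point set. -/
lemma IsSimpleCurveEndingAt.forall_of_eventually (hγ : IsSimpleCurveEndingAt γ ζ) (hζ : ‖ζ‖ = 1)
    {P : ℝ → Prop} (hP : ∀ᶠ t in 𝓝[<] (1 : ℝ), P t) :
    ∃ R : ℝ, ∀ t ∈ Ico (0 : ℝ) 1, R ≤ ‖toHalf ζ (γ t)‖ → P t := by
  obtain ⟨l, hl, hlP⟩ := mem_nhdsLT_iff_exists_Ioo_subset.1 hP
  have hl : l < 1 := hl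
  obtain ⟨M, hM⟩ := (isCompact_Icc (a := (0 : ℝ)) (b := l)).exists_bound_of_continuousOn
    ((hγ.continuousOn_toHalf hζ).mono fun t ht => ⟨ht.1, ht.2.trans_lt hl⟩)
  refine ⟨M + 1, fun t ht htM => hlP ⟨?_, ht.2⟩⟩
  by_contra! hle
  linarith [hM t ⟨ht.1, hle⟩]

/-- Near any given point only a compact part of the curve matters, as the rest is far away.
Closedness provides the lowest point used for the strict inclusion. -/
lemma IsSimpleCurveEndingAt.isClosed_toHalf_image (hγ : IsSimpleCurveEndingAt γ ζ)
    (hζ : ‖ζ‖ = 1) : IsClosed (toHalf ζ '' curveTrace γ) := by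
  refine isClosed_of_closure_subset fun w hw => ?_
  obtain ⟨l, hl, hlP⟩ := mem_nhdsLT_iff_exists_Ioo_subset.1
    ((hγ.tendsto_norm_toHalf hζ).eventually (eventually_ge_atTop (‖w‖ + 1)))
  have hl : l < 1 := hl
  have hsub : Icc 0 l ⊆ Ico (0 : ℝ) 1 := fun t ht => ⟨ht.1, ht.2.trans_lt hl⟩
  have hclosed : IsClosed ((fun t => toHalf ζ (γ t)) '' Icc 0 l) :=
    (isCompact_Icc.image_of_continuousOn ((hγ.continuousOn_toHalf hζ).mono hsub)).isClosed
  have h1 : w ∈ closure (Metric.ball 0 (‖w‖ + 1) ∩ toHalf ζ '' curveTrace γ) :=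
    Metric.isOpen_ball.inter_closure ⟨by simp, hw⟩
  have h2 : Metric.ball 0 (‖w‖ + 1) ∩ toHalf ζ '' curveTrace γ ⊆
      (fun t => toHalf ζ (γ t)) '' Icc 0 l := by
    rintro _ ⟨hb, _, ⟨t, ht, rfl⟩, rfl⟩
    refine ⟨t, ⟨ht.1, ?_⟩, rfl⟩
    by_contra! hlt
    have : ‖w‖ + 1 ≤ ‖toHalf ζ (γ t)‖ := hlP ⟨hlt, ht.2⟩
    rw [mem_ball_zero_iff] at hb
    linarith
  obtain ⟨t, ht, htw⟩ := closure_minimal h2 hclosed h1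
  exact ⟨γ t, ⟨t, hsub ht, rfl⟩, htw⟩

/-- If `d` is the unit direction from `ζ` to `γ t`, then `w + i` is a positive multiple of `-iζ ·
conj d`, which tends to `σ` when `d → -σ iζ`. -/
lemma IsSimpleCurveEndingAt.slope_toHalf (hγ : IsSimpleCurveEndingAt γ ζ) (hζ : ‖ζ‖ = 1) {σ : ℝ}
    (hσ : σ = 1 ∨ σ = -1)
    (htan : Tendsto (fun t => (γ t - ζ) / (‖γ t - ζ‖ : ℂ)) (𝓝[<] 1)
      (𝓝 (-(σ * (Complex.I * ζ))))) {ε : ℝ} (hε : 0 < ε) :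
    ∃ R : ℝ, ∀ w ∈ toHalf ζ '' curveTrace γ, R ≤ ‖w‖ → w.im ≤ ε * (σ * w.re) := by
  have hζ0 : ζ * (starRingEnd ℂ) ζ = 1 := by rw [Complex.mul_conj', hζ]; norm_num
  set d : ℝ → ℂ := fun t => (γ t - ζ) / (‖γ t - ζ‖ : ℂ) with hd
  set u : ℝ → ℂ := fun t => -(Complex.I * ζ) * (starRingEnd ℂ) (d t) with hu
  have hulim : Tendsto u (𝓝[<] 1) (𝓝 (σ : ℂ)) := by
    have h1 := ((Complex.continuous_conj.tendsto _).comp htan).const_mul (-(Complex.I * ζ))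
    have e : -(Complex.I * ζ) * (starRingEnd ℂ) (-(σ * (Complex.I * ζ))) = σ := by
      simp only [map_neg, map_mul, Complex.conj_ofReal, Complex.conj_I]
      linear_combination (-σ * Complex.I ^ 2) * hζ0 - σ * Complex.I_sq
    rwa [e] at h1
  have hre : Tendsto (fun t => σ * (u t).re) (𝓝[<] 1) (𝓝 1) := by
    have h1 := ((Complex.continuous_re.tendsto _).comp hulim).const_mul σ
    have h2 : σ * σ = 1 := by rcases hσ with rfl | rfl <;> norm_num
    rwa [Complex.ofReal_re, h2] at h1
  have him : Tendsto (fun t => (u t).im) (𝓝[<] 1) (𝓝 0) := by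
    have h1 := (Complex.continuous_im.tendsto _).comp hulim
    rwa [Complex.ofReal_im] at h1
  obtain ⟨R, hR⟩ := hγ.forall_of_eventually hζ
    ((hre.eventually (lt_mem_nhds (by norm_num : (1 / 2 : ℝ) < 1))).and
      (him.eventually (gt_mem_nhds (half_pos hε))))
  refine ⟨R, ?_⟩
  rintro _ ⟨_, ⟨t, ht, rfl⟩, rfl⟩ hRw
  obtain ⟨h1, h2⟩ := hR t ht hRw
  have h0 := sub_ne_zero_of_mem_unitDisc hζ (hγ.mapsTo ht)
  have hpos : 0 < ‖γ t - ζ‖ := by rw [norm_sub_rev]; exact norm_pos_iff.2 h0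
  have hW : toHalf ζ (γ t) + Complex.I = ((2 / ‖γ t - ζ‖ : ℝ) : ℂ) * u t := by
    have hp : (‖γ t - ζ‖ : ℂ) ≠ 0 := by exact_mod_cast hpos.ne'
    have hsq : (γ t - ζ) * (starRingEnd ℂ) (γ t - ζ) = (‖γ t - ζ‖ : ℂ) ^ 2 := Complex.mul_conj' _
    rw [toHalf_add_I h0, hu, hd]
    simp only [map_div₀, Complex.conj_ofReal]
    push_cast
    rw [div_eq_iff h0]
    field_simp
    linear_combination (-ζ) * hsq
  have hWre := congrArg Complex.re hW
  have hWim := congrArg Complex.im hW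
  rw [Complex.add_re, Complex.I_re, add_zero, Complex.re_ofReal_mul] at hWre
  rw [Complex.add_im, Complex.I_im, Complex.im_ofReal_mul] at hWim
  have hT : 0 < 2 / ‖γ t - ζ‖ := by positivity
  have e1 : (2 / ‖γ t - ζ‖) * (u t).im ≤ (2 / ‖γ t - ζ‖) * (ε / 2) :=
    mul_le_mul_of_nonneg_left h2.le hT.le
  have e2 : (2 / ‖γ t - ζ‖) * (ε * (1 / 2)) ≤ (2 / ‖γ t - ζ‖) * (ε * (σ * (u t).re)) := by
    gcongr
  rw [hWre]
  nlinarith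

end Curve

lemma hasTangentialLimit_of_curve {f : ℂ → OnePoint ℂ} (hf : IsMeromorphicOnDisc f)
    (hN : IsNormalOnDisc f) {γ : ℝ → ℂ} {ζ : ℂ} (hζ : ‖ζ‖ = 1) (hγ : IsSimpleCurveEndingAt γ ζ)
    (htan : IsTangentToCircleAt γ ζ) {c : OnePoint ℂ}
    (hc : Tendsto f (𝓝[curveTrace γ] ζ) (𝓝 c)) :
    ∃ σ : ℝ, HasTangentialLimit (fun w => f (fromHalf ζ w)) (toHalf ζ '' curveTrace γ) σ c := by
  obtain ⟨σ, hσ, htan'⟩ : ∃ σ : ℝ, (σ = 1 ∨ σ = -1) ∧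
      Tendsto (fun t => (γ t - ζ) / (‖γ t - ζ‖ : ℂ)) (𝓝[<] 1) (𝓝 (-(σ * (Complex.I * ζ)))) := by
    rcases htan with h | h
    · exact ⟨-1, Or.inr rfl, by simpa using h⟩
    · exact ⟨1, Or.inl rfl, by simpa using h⟩
  refine ⟨σ, ?_⟩
  have htr : ∀ z ∈ curveTrace γ, z ∈ unitDisc := by
    rintro _ ⟨t, ht, rfl⟩
    exact hγ.mapsTo ht
  exact {
    analytic := fun w hw => (hf.sphericallyAnalyticAt (fromHalf_mem hζ hw)).comp
      (analyticAt_fromHalf ζ (add_I_ne_zero (mem_upperHalf.1 hw).le))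
    normal := isAffineNormal_comp_fromHalf (fun z hz => hf.sphericallyAnalyticAt hz) hN hζ
    subset := by
      rintro _ ⟨z, hz, rfl⟩
      exact toHalf_mem hζ (htr z hz)
    isPreconnected := by
      rw [curveTrace, image_image]
      exact isPreconnected_Ico.image _ (hγ.continuousOn_toHalf hζ)
    unbounded := fun R => by
      obtain ⟨t, ht, htR⟩ := (hγ.eventually_mem_Ico.and
        ((hγ.tendsto_norm_toHalf hζ).eventually (eventually_ge_atTop R))).exists
      exact ⟨_, ⟨γ t, ⟨t, ht, rfl⟩, rfl⟩, htR⟩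
    limit := by
      intro O hO
      have h1 : Tendsto (fun t => f (γ t)) (𝓝[<] 1) (𝓝 c) :=
        hc.comp (tendsto_nhdsWithin_iff.2 ⟨hγ.tendsto,
          hγ.eventually_mem_Ico.mono fun t ht => ⟨t, ht, rfl⟩⟩)
      obtain ⟨R, hR⟩ := hγ.forall_of_eventually hζ (h1.eventually hO)
      refine ⟨R, ?_⟩
      rintro _ ⟨_, ⟨t, ht, rfl⟩, rfl⟩ hRw
      have := hR t ht hRw
      rwa [← fromHalf_toHalf hζ (sub_ne_zero_of_mem_unitDisc hζ (hγ.mapsTo ht))] at this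
    slope := fun ε hε => hγ.slope_toHalf hζ hσ htan' hε
    sign := hσ }

/-- The chord of angle `α` goes to the ray from `-i` in direction `-e^{-iα}`; its angle is counted
from the side on which the curve escapes. -/
lemma exists_arcPt_eq {σ : ℝ} (hσ : σ = 1 ∨ σ = -1) {α : ℝ} (hα : α ∈ Ioo 0 Real.pi) :
    ∃ a ∈ Ioo 0 Real.pi, arcPt σ a = ⟨-Real.cos α, Real.sin α⟩ := by
  rcases hσ with rfl | rfl
  · exact ⟨Real.pi - α, ⟨by linarith [hα.2], by linarith [hα.1]⟩, by
      rw [arcPt, Real.cos_pi_sub, Real.sin_pi_sub, one_mul]⟩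
  · exact ⟨α, hα, by rw [arcPt, neg_one_mul]⟩

/-- A closure point on the real line would give a frontier point of `U` on the unit circle other
than `ζ`, which is excluded. The circle of radius `ρ` goes to `|w + i| = 2 / ρ`, where `‖w‖ ≤ 2 / ρ
+ 1`, hence the bound `2 / ρ + 2`. -/
lemma IsDomainBoundedBy.isBoundedByRay {γ : ℝ → ℂ} {θ α ρ : ℝ} {U : Set ℂ}
    (hU : IsDomainBoundedBy γ θ α ρ U) (hγ : IsSimpleCurveEndingAt γ (circlePt θ)) (hρ : 0 < ρ)
    {σ a : ℝ} (ha : arcPt σ a = ⟨-Real.cos α, Real.sin α⟩) :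
    IsBoundedByRay (upperHalf ∩ fromHalf (circlePt θ) ⁻¹' U) (toHalf (circlePt θ) '' curveTrace γ)
      σ a (2 / ρ + 2) := by
  have hζ := norm_circlePt θ
  set ζ := circlePt θ with hζdef
  have hζ0 : ζ ≠ 0 := norm_ne_zero_iff.1 (by rw [hζ]; norm_num)
  have hopen : IsOpen (upperHalf ∩ fromHalf ζ ⁻¹' U) := by
    refine ContinuousOn.isOpen_inter_preimage (fun w hw => ?_) isOpen_upperHalf hU.isOpen
    exact (analyticAt_fromHalf ζ
      (add_I_ne_zero (mem_upperHalf.1 hw).le)).continuousAt.continuousWithinAt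
  have hcl : ∀ w ∈ closure (upperHalf ∩ fromHalf ζ ⁻¹' U), 0 ≤ w.im ∧
      fromHalf ζ w ∈ closure U := by
    intro w hw
    have h1 : 0 ≤ w.im := by
      have : closure upperHalf ⊆ {w : ℂ | 0 ≤ w.im} :=
        closure_minimal (fun w hw => (mem_upperHalf.1 hw).le)
          (isClosed_le continuous_const Complex.continuous_im)
      exact this (closure_mono inter_subset_left hw)
    refine ⟨h1, ?_⟩
    exact mem_closure_image (s := upperHalf ∩ fromHalf ζ ⁻¹' U)
      (analyticAt_fromHalf ζ (add_I_ne_zero h1)).continuousAt hw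
      |> closure_mono (by rintro _ ⟨v, hv, rfl⟩; exact hv.2)
  have hneζ : ∀ w : ℂ, 0 ≤ w.im → fromHalf ζ w ≠ ζ := by
    intro w hw h
    have h1 := fromHalf_sub (ζ := ζ) (add_I_ne_zero hw)
    rw [h, sub_self, eq_comm, div_eq_zero_iff] at h1
    rcases h1 with h1 | h1
    · simp [hζ0] at h1
    · exact add_I_ne_zero hw h1
  have hclH : closure (upperHalf ∩ fromHalf ζ ⁻¹' U) ⊆ upperHalf := by
    intro w hw
    obtain ⟨h1, h2⟩ := hcl w hw
    refine lt_of_le_of_ne h1 fun h0 => ?_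
    have h3 := one_sub_norm_fromHalf_sq hζ (add_I_ne_zero h1)
    rw [← h0, mul_zero, zero_div] at h3
    have h4 : fromHalf ζ w ∉ unitDisc := fun h5 => by
      have h5 : ‖fromHalf ζ w‖ < 1 := h5
      nlinarith [norm_nonneg (fromHalf ζ w)]
    have h6 : fromHalf ζ w ∈ frontier U := by
      rw [hU.isOpen.frontier_eq]
      exact ⟨h2, fun h7 => h4 (hU.subset_disc h7)⟩
    rcases hU.frontier_subset h6 with ((⟨t, ht, htw⟩ | h7) | h7) | h7
    · exact h4 (htw ▸ hγ.mapsTo ht)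
    · exact h4 h7.1
    · exact h4 h7.2
    · exact hneζ w h1 h7
  refine ⟨hopen, hclH, fun w hw hR => ?_⟩
  have hwH := hclH (frontier_subset_closure hw)
  have hw0 : w + Complex.I ≠ 0 := add_I_ne_zero (mem_upperHalf.1 hwH).le
  have h6 : fromHalf ζ w ∈ frontier U := by
    rw [hopen.frontier_eq] at hw
    rw [hU.isOpen.frontier_eq]
    exact ⟨(hcl w hw.1).2, fun h7 => hw.2 ⟨hwH, h7⟩⟩
  have hsub := fromHalf_sub (ζ := ζ) hw0
  rcases hU.frontier_subset h6 with ((h7 | ⟨-, t, ht, h7⟩) | ⟨h7, -⟩) | h7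
  · exact Or.inl ⟨_, h7, toHalf_fromHalf hζ hw0⟩
  · refine Or.inr ⟨2 / t, by positivity, ?_⟩
    rw [h7, ← hζdef, add_sub_cancel_left, eq_div_iff hw0] at hsub
    have ht0 : (t : ℂ) ≠ 0 := by exact_mod_cast ht.ne'
    have e1 : t * Complex.exp (α * Complex.I) * (w + Complex.I) = -2 :=
      mul_left_cancel₀ (mul_ne_zero Complex.I_ne_zero hζ0) (by linear_combination hsub)
    have e2 : (arcPt σ a : ℂ) = -Complex.exp (-(α * Complex.I)) := by
      rw [ha, ← neg_mul, Complex.exp_mul_I, ← Complex.ofReal_neg, ← Complex.ofReal_cos,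
        ← Complex.ofReal_sin, Real.cos_neg, Real.sin_neg]
      apply Complex.ext <;> simp [-Complex.ofReal_cos, -Complex.ofReal_sin]
    have e3 : Complex.exp (α * Complex.I) * Complex.exp (-(α * Complex.I)) = 1 := by
      rw [← Complex.exp_add, add_neg_cancel, Complex.exp_zero]
    rw [e2]
    push_cast
    rw [div_mul_eq_mul_div, eq_div_iff ht0]
    linear_combination Complex.exp (-(α * Complex.I)) * e1 - t * (w + Complex.I) * e3
  · exfalso
    have h8 := mem_sphere_iff_norm.1 h7
    rw [← hζdef, hsub, norm_div, norm_neg, norm_mul, norm_mul, hζ, Complex.norm_two,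
      Complex.norm_I, mul_one, mul_one, div_eq_iff (norm_ne_zero_iff.2 hw0)] at h8
    have h9 : ‖w + Complex.I‖ = 2 / ρ := by rw [h8]; field_simp
    have h10 := norm_sub_norm_le w (-Complex.I)
    rw [norm_neg, Complex.norm_I, sub_neg_eq_add, h9] at h10
    linarith
  · exact absurd h7 (hneζ w (mem_upperHalf.1 hwH).le)

/-- The affine map taking `i` to `q` carries the fixed compact set `hypDiscI r` onto the disc about
`q`. Since `‖p‖ ≤ ‖q‖ (1 + M)`, a far point `p` has a far centre `q`, and
`eventually_mem_of_compact` applies. -/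
lemma HasTangentialLimit.eventually_mem_of_pseudoHypDist_le {F : ℂ → OnePoint ℂ} {C : Set ℂ}
    {σ : ℝ} {c : OnePoint ℂ} (h : HasTangentialLimit F C σ c) {ζ : ℂ} (hζ : ‖ζ‖ = 1) {r : ℝ}
    (hr : r ∈ Ioo (0 : ℝ) 1) {O : Set (OnePoint ℂ)} (hO : O ∈ 𝓝 c) :
    ∃ R : ℝ, ∀ p ∈ upperHalf, R ≤ ‖p‖ →
      (∃ q ∈ C, pseudoHypDist (fromHalf ζ p) (fromHalf ζ q) ≤ r) → F p ∈ O := by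
  obtain ⟨R, hR⟩ := h.eventually_mem_of_compact (isCompact_hypDiscI hr.2)
    (hypDiscI_subset hr.1.le hr.2) hO
  set M : ℝ := (1 + |r|) / (1 - r) with hM
  have hM0 : 0 ≤ M := div_nonneg (by positivity) (by linarith [hr.2])
  refine ⟨R * (1 + M), fun p hp hpR ⟨q, hq, hpq⟩ => ?_⟩
  have hqH := h.subset hq
  have hqi : 0 < q.im := hqH
  have hqi0 : (q.im : ℂ) ≠ 0 := by exact_mod_cast hqi.ne'
  have hle := norm_sub_I_le_of_pseudoHypDist_le hζ hp hqH hpq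
  set v : ℂ := (p - q.re) / q.im with hv
  have hpv : q.im * v + q.re = p := by rw [hv]; field_simp; ring
  have e1 : v - Complex.I = (p - q) / q.im := by
    rw [hv, eq_div_iff hqi0, sub_mul, div_mul_cancel₀ _ hqi0]
    nth_rewrite 3 [← Complex.re_add_im q]
    ring
  have e2 : v + Complex.I = (p - (starRingEnd ℂ) q) / q.im := by
    have : (starRingEnd ℂ) q = q.re - q.im * Complex.I := by
      apply Complex.ext <;> simp
    rw [hv, eq_div_iff hqi0, add_mul, div_mul_cancel₀ _ hqi0, this]
    ring
  have hvK : v ∈ hypDiscI r := by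
    change ‖v - Complex.I‖ ≤ r * ‖v + Complex.I‖
    rw [e1, e2, norm_div, norm_div, ← mul_div_assoc]
    gcongr
  have hvn := norm_le_of_mem_hypDiscI hr.2 hvK
  have hpn : ‖p‖ ≤ ‖q‖ * (1 + M) := by
    rw [← hpv]
    have h1 := norm_add_le (q.im * v : ℂ) q.re
    rw [norm_mul, Complex.norm_real, Complex.norm_real] at h1
    have h2 : ‖q.im‖ * ‖v‖ ≤ ‖q‖ * M :=
      mul_le_mul (Complex.abs_im_le_norm q) hvn (norm_nonneg _) (norm_nonneg _)
    have h3 : ‖q.re‖ ≤ ‖q‖ := Complex.abs_re_le_norm q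
    linarith
  rw [← hpv]
  exact hR q hq (le_of_mul_le_mul_right (hpR.trans hpn) (by linarith)) v hvK

theorem theorem8p1 (f : ℂ → OnePoint ℂ) (hf : IsMeromorphicOnDisc f) (hN : IsNormalOnDisc f)
    (θ : ℝ) (γ : ℝ → ℂ) (hγ : IsSimpleCurveEndingAt γ (circlePt θ))
    (htan : IsTangentToCircleAt γ (circlePt θ))
    (c : OnePoint ℂ) (hc : Tendsto f (𝓝[curveTrace γ] (circlePt θ)) (𝓝 c)) :
    (∀ r ∈ Ioo (0 : ℝ) 1, ∀ ρ ∈ Ioo (0 : ℝ) 1, ∀ α ∈ Ioo (0 : ℝ) Real.pi,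
      clusterSetAlong f (enlargedRegion γ θ r α ρ) (circlePt θ) = {c} ∧
      chordalRegion γ θ α ρ ⊂ enlargedRegion γ θ r α ρ) ∧
    (⋃ r ∈ Ioo (0 : ℝ) 1, ⋃ ρ ∈ Ioo (0 : ℝ) 1, ⋃ α ∈ Ioo (0 : ℝ) Real.pi,
      clusterSetAlong f (enlargedRegion γ θ r α ρ) (circlePt θ)) = {c} := by
  have hζ := norm_circlePt θ
  obtain ⟨σ, h⟩ := hasTangentialLimit_of_curve hf hN hζ hγ htan hc
  have htr : ∀ z ∈ curveTrace γ, z ∈ unitDisc := by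
    rintro _ ⟨t, ht, rfl⟩
    exact hγ.mapsTo ht
  have hback : ∀ z ∈ unitDisc, fromHalf (circlePt θ) (toHalf (circlePt θ) z) = z := fun z hz =>
    fromHalf_toHalf hζ (sub_ne_zero_of_mem_unitDisc hζ hz)
  have hdisc : ∀ r α ρ : ℝ, ∀ z ∈ enlargedRegion γ θ r α ρ, z ∈ unitDisc := by
    rintro r α ρ z (hz | ⟨U, hU, hz⟩)
    · exact hz.1
    · exact hU.subset_disc hz
  have htrace : ∀ r > 0, curveTrace γ ⊆ curvilinearAngle γ r := fun r hr z hz =>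
    ⟨htr z hz, z, hz, by simpa [pseudoHypDist] using hr.le⟩
  have main : ∀ r ∈ Ioo (0 : ℝ) 1, ∀ ρ ∈ Ioo (0 : ℝ) 1, ∀ α ∈ Ioo (0 : ℝ) Real.pi,
      clusterSetAlong f (enlargedRegion γ θ r α ρ) (circlePt θ) = {c} ∧
      chordalRegion γ θ α ρ ⊂ enlargedRegion γ θ r α ρ := by
    intro r hr ρ hρ α hα
    obtain ⟨a, ha, haα⟩ := exists_arcPt_eq h.sign hα
    refine ⟨Subset.antisymm ?_ ?_, subset_union_right, fun hsub => ?_⟩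
    · rintro w ⟨z, hzG, hz, hfz⟩
      refine tendsto_nhds_unique hfz fun O hO => ?_
      obtain ⟨R₁, hR₁⟩ := h.eventually_mem_of_pseudoHypDist_le hζ hr hO
      obtain ⟨R₂, hR₂⟩ := h.eventually_mem_of_boundedByRay ha (2 / ρ + 2) hO
      have hz0 : Tendsto (fun n => ‖z n - circlePt θ‖) atTop (𝓝[>] 0) := by
        refine tendsto_nhdsWithin_iff.2 ⟨by simpa using (hz.sub_const (circlePt θ)).norm,
          Eventually.of_forall fun n => ?_⟩
        have := sub_ne_zero_of_mem_unitDisc hζ (hdisc r α ρ _ (hzG n))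
        rw [norm_sub_rev]
        exact norm_pos_iff.2 this
      have hev : ∀ᶠ n in atTop, f (z n) ∈ O := by
        -- The threshold comes from `2 / ‖z - ζ‖ = ‖w + i‖ ≤ ‖w‖ + 1` for `w = toHalf ζ z`.
        filter_upwards [(tendsto_inv_nhdsGT_zero.comp hz0).eventually
          (eventually_ge_atTop ((max R₁ R₂ + 1) / 2))] with n hn
        have hzD := hdisc r α ρ _ (hzG n)
        have hH := toHalf_mem hζ hzD
        have hlarge : max R₁ R₂ ≤ ‖toHalf (circlePt θ) (z n)‖ := by
          have h1 := norm_toHalf_add_I hζ (sub_ne_zero_of_mem_unitDisc hζ hzD)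
          have h2 := norm_add_le (toHalf (circlePt θ) (z n)) Complex.I
          rw [h1, Complex.norm_I, div_eq_mul_inv] at h2
          simp only [Function.comp] at hn
          linarith
        rw [← hback _ hzD]
        rcases hzG n with ⟨-, q, hq, hpq⟩ | ⟨U, hU, hzU⟩
        · refine hR₁ _ hH ((le_max_left _ _).trans hlarge) ⟨_, ⟨q, hq, rfl⟩, ?_⟩
          rwa [hback _ hzD, hback _ (htr q hq)]
        · refine hR₂ _ (hU.isBoundedByRay hγ hρ.1 haα) _ ⟨hH, ?_⟩ ((le_max_right _ _).trans hlarge)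
          rwa [mem_preimage, hback _ hzD]
      exact hev
    · rintro _ rfl
      obtain ⟨t, -, ht, htlim⟩ := exists_seq_strictMono_tendsto' (zero_lt_one' ℝ)
      have htl : Tendsto t atTop (𝓝[<] 1) :=
        tendsto_nhdsWithin_iff.2 ⟨htlim, Eventually.of_forall fun n => (ht n).2⟩
      have hmem : ∀ n, γ (t n) ∈ curveTrace γ := fun n => ⟨t n, Ioo_subset_Ico_self (ht n), rfl⟩
      have hlim := hγ.tendsto.comp htl
      exact ⟨fun n => γ (t n), fun n => Or.inl (htrace r hr.1 (hmem n)), hlim,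
        hc.comp (tendsto_nhdsWithin_iff.2 ⟨hlim, Eventually.of_forall hmem⟩)⟩
    · obtain ⟨_, ⟨z, hz, rfl⟩, hnot⟩ := h.exists_not_mem_of_boundedByRay
        (hγ.isClosed_toHalf_image hζ) ha (2 / ρ + 2)
      obtain ⟨U, hU, hzU⟩ := hsub (Or.inl (htrace r hr.1 hz))
      refine hnot _ (hU.isBoundedByRay hγ hρ.1 haα) ⟨toHalf_mem hζ (htr z hz), ?_⟩
      rwa [mem_preimage, hback _ (htr z hz)]
  refine ⟨main, Subset.antisymm ?_ ?_⟩
  · simp only [iUnion_subset_iff]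
    exact fun r hr ρ hρ α hα => (main r hr ρ hρ α hα).1.subset
  · have hhalf : (1 / 2 : ℝ) ∈ Ioo (0 : ℝ) 1 := by norm_num
    have hpi : Real.pi / 2 ∈ Ioo 0 Real.pi := ⟨by positivity, by linarith [Real.pi_pos]⟩
    rw [← (main _ hhalf _ hhalf _ hpi).1]
    intro w hw
    simp only [mem_iUnion]
    exact ⟨_, hhalf, _, hhalf, _, hpi, hw⟩
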